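/- Setting. Write $x=(x',x_3)\in\mathbb R^2\times\mathbb R$. Let $v_1,v_2$ be a basis of $\mathbb R^2$, $\Lambda=\mathbb Zv_1+\mathbb Zv_2$, $Y=\{c_1v_1+c_2v_2: |c_i|\le \tfrac12\}$ with $|Y|=1$, $\Lambda^*=\{q: q\cdot\gamma\in2\pi\mathbb Z\ \ \forall\gamma\in\Lambda\}$, and let $\mathcal B=\{\alpha\in\mathbb R^2: |\alpha|\le|\alpha-q|\ \ \forall q\in\Lambda^*\}$ be the first Brillouin zone. Let $D\subset Y\times[-h,h]$ (for some $h>0$) be a bounded open set with smooth boundary, and let $\mathcal D=\bigcup_{\gamma\in\Lambda}(D+(\gamma,0))$ be the metasurface. An isometry $g$ of $\mathbb R^2$ acts on $\mathbb R^3$ by $gx=(gx',x_3)$; $\bar g$ denotes its orthogonal linear part, acting on $\mathbb R^2$ and (fixing the third component) on $\mathbb C^3$. Let $\mathcal G$ be the group of plane isometries $g$ with $g(\mathcal D)=\mathcal D$, and $\bar{\mathcal G}=\{\bar g: g\in\mathcal G\}$ the point group. Assume that the translation vectors of the translations in $\mathcal G$ are exactly the elements of $\Lambda$. Let $\tau>0$.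 For $\alpha\in\mathbb R^2$ and $\omega\in\mathbb C$ with $\omega^2\notin Z(\alpha):=\{|\alpha+q|^2:q\in\Lambda^*\}$ put $\beta_q=\sqrt{\omega^2-|\alpha+q|^2}$, with the branch of the square root cut along the negative imaginary axis and positive on $(0,\infty)$, and $$G^{\alpha,\omega}(x)=\tfrac12\sum_{q\in\Lambda^*} i\beta_q^{-1}e^{i(\alpha+q)\cdot x'}e^{i\beta_q|x_3|},\qquad \mathcal T_D^{\alpha,\omega}[\varphi]=(\omega^2+\nabla\operatorname{div})\int_D G^{\alpha,\omega}(\cdot-y)\varphi(y)\,dy$$ (a distribution on $\mathbb R^3$). Let $\mathcal A_\tau(\alpha,\omega)=\tau^{-1}-\mathcal T_D^{\alpha,\omega}$ on $\mathbf H(\operatorname{div}0,D)=\{\varphi\in L^2(D;\mathbb C^3):\operatorname{div}\varphi=0\}$. The resonances at $\alpha$ are the $\omega\in\mathbb C$ with $\omega^2\notin Z(\alpha)$ such that $\mathcal A_\tau(\alpha,\omega)$ is not invertible (with bounded inverse). Fix any total order on $\mathbb C$ (for instance by modulus, then by argument); the band dispersion function $\omega_j(\alpha)$, $j\ge0$,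 is the $j$-th resonance at $\alpha$ in this order, counted with geometric multiplicity $\dim\ker\mathcal A_\tau(\alpha,\omega)$ (undefined if there is none). Let $\mathbf L^2_\alpha(D)$ be the space of quasi-periodic extensions $\sum_{\gamma\in\Lambda}(f\chi_D)(x-(\gamma,0))e^{i\alpha\cdot\gamma}$, $f\in L^2(D;\mathbb C^3)$. An eigenfunction of $\mathcal A_\tau(\alpha,\omega)$ is a nonzero $\varphi\in\mathbf L^2_\alpha(D)$ with $\operatorname{div}\varphi=0$ in $D$ and $\mathcal A_\tau(\alpha,\omega)[\varphi|_D]=0$. For a vector field $\varphi$ put $\mathcal O_g\varphi(x)=\bar g\,\varphi(g^{-1}x)$. Claim. (1) For all $\bar g\in\bar{\mathcal G}$ and $\alpha\in\mathcal B$: $\bar g\alpha\in\mathcal B$, the resonances at $\bar g\alpha$ and at $\alpha$ are the same, with the same geometric multiplicities, and $\omega_j(\bar g\alpha)=\omega_j(\alpha)$ for every $j\ge0$ (both sides being defined or both undefined). (2) If $g\in\mathcal G$, $\alpha\in\mathcal B$, $\omega$ is a resonance at $\alpha$ and $\varphi\in\mathbf L^2_\alpha(D)$ is an eigenfunction of $\mathcal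 A_\tau(\alpha,\omega)$, then $\omega$ is a resonance at $\bar g\alpha$ and $\mathcal O_g\varphi\in\mathbf L^2_{\bar g\alpha}(D)$ is an eigenfunction of $\mathcal A_\tau(\bar g\alpha,\omega)$. (3) For $g\in\mathcal G$, $\alpha\in\mathcal B$, $\omega\in\mathbb C$ with $\omega^2\notin Z(\alpha)$ and $\varphi\in\mathbf L^2_\alpha(D)$, $$\mathcal T_D^{\bar g\alpha,\omega}[\mathcal O_g\varphi]=\mathcal O_g\,\mathcal T_D^{\alpha,\omega}[\varphi]$$ as distributions on $\mathbb R^3$ (where $\langle\mathcal O_gT,\mathcal O_g\theta\rangle=\langle T,\theta\rangle$ for test fields $\theta$), and hence also as fields on $\mathbb R^3$. -/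

import Mathlib

open MeasureTheory Topology
open scoped Real

namespace Metasurface

noncomputable section

/-- The horizontal plane `ℝ²`, in which the lattice and the quasi-momenta live. -/
abbrev Plane : Type := EuclideanSpace ℝ (Fin 2)

/-- Physical space `ℝ³`, written as `x = (x', x₃)` with `x' ∈ ℝ²` and `x₃ ∈ ℝ`. -/
abbrev Space : Type := Plane × ℝ

/-- Complex vectors `ℂ³`, the values of electric fields. -/
abbrev CVec : Type := EuclideanSpace ℂ (Fin 3)

/-! ### The lattice, the reciprocal lattice, the Brillouin zone -/

/-- The lattice `Λ = {n₁ v₁ + n₂ v₂ : n₁, n₂ ∈ ℤ}`. -/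
def lattice (v : Module.Basis (Fin 2) ℝ Plane) : AddSubgroup Plane :=
  (Submodule.span ℤ (Set.range v)).toAddSubgroup

/-- The fundamental cell `Y = {c₁ v₁ + c₂ v₂ : c₁, c₂ ∈ [-1/2, 1/2]}`. -/
def cell (v : Module.Basis (Fin 2) ℝ Plane) : Set Plane :=
  {x | ∃ c : Fin 2 → ℝ, (∀ i, c i ∈ Set.Icc (-(1 / 2) : ℝ) (1 / 2)) ∧ x = ∑ i, c i • v i}

/-- The reciprocal lattice `Λ* = {q : q · γ ∈ 2πℤ for all γ ∈ Λ}`. -/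
def dualLattice (v : Module.Basis (Fin 2) ℝ Plane) : Set Plane :=
  {q | ∀ γ ∈ lattice v, ∃ n : ℤ, inner ℝ q γ = 2 * π * n}

/-- The first Brillouin zone `{α : |α| ≤ |α - q| for all q ∈ Λ*}`. -/
def brillouinZone (v : Module.Basis (Fin 2) ℝ Plane) : Set Plane :=
  {α | ∀ q ∈ dualLattice v, ‖α‖ ≤ ‖α - q‖}

/-! ### The metasurface and its symmetries -/

/-- The boundary of the set `D` is smooth: near each of its boundary points, `D` is the
sublevel set `{ρ < 0}` of a smooth function `ρ` with nonvanishing differential. -/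
def HasSmoothBoundary (D : Set Space) : Prop :=
  ∀ p ∈ frontier D, ∃ ρ : Space → ℝ, ContDiff ℝ ((⊤ : ℕ∞) : WithTop ℕ∞) ρ ∧ fderiv ℝ ρ p ≠ 0 ∧
    ∀ᶠ x in 𝓝 p, (x ∈ D ↔ ρ x < 0)

/-- The metasurface `𝒟 = ⋃_{γ ∈ Λ} (D + (γ, 0))`. -/
def metasurface (v : Module.Basis (Fin 2) ℝ Plane) (D : Set Space) : Set Space :=
  {x | ∃ γ ∈ lattice v, x - ((γ, 0) : Space) ∈ D}

/-- The extension `g x = (g x', x₃)` of an isometry of the plane to `ℝ³`. -/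
def planeExtend (g : Plane ≃ᵃⁱ[ℝ] Plane) (x : Space) : Space := (g x.1, x.2)

/-- The symmetry group `𝒢`: the isometries `g` of the plane with `g(𝒟) = 𝒟`. -/
def symmetryGroup (v : Module.Basis (Fin 2) ℝ Plane) (D : Set Space) :
    Subgroup (Plane ≃ᵃⁱ[ℝ] Plane) where
  carrier := {g | planeExtend g '' metasurface v D = metasurface v D}
  one_mem' := by
    change planeExtend 1 '' _ = _
    have : planeExtend 1 = id := rfl
    rw [this, Set.image_id]
  mul_mem' := by
    intro a b ha hb
    change planeExtend (a * b) '' _ = _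
    have : planeExtend (a * b) = planeExtend a ∘ planeExtend b := rfl
    rw [this, Set.image_comp, hb, ha]
  inv_mem' := by
    intro a ha
    change planeExtend a⁻¹ '' _ = _
    have h : planeExtend a⁻¹ ∘ planeExtend a = id := by
      funext x
      exact Prod.ext (a.symm_apply_apply x.1) rfl
    have ha' : planeExtend a '' metasurface v D = metasurface v D := ha
    conv_lhs => rw [← ha']
    rw [← Set.image_comp, h, Set.image_id]

/-- The point group: the orthogonal linear parts `ḡ` of the elements `g` of `𝒢`. -/
def pointGroup (v : Module.Basis (Fin 2) ℝ Plane) (D : Set Space) :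
    Set (Plane ≃ₗᵢ[ℝ] Plane) :=
  {R | ∃ g ∈ symmetryGroup v D, g.linearIsometryEquiv = R}

/-- The vectors of the translations that belong to `𝒢`. -/
def translationVectors (v : Module.Basis (Fin 2) ℝ Plane) (D : Set Space) : Set Plane :=
  {a | AffineIsometryEquiv.constVAdd ℝ Plane a ∈ symmetryGroup v D}

/-- The action on `ℂ³` of an orthogonal map of the plane: its matrix acts on the first two
components, and the third one is fixed. -/
def rotate (R : Plane ≃ₗᵢ[ℝ] Plane) (w : CVec) : CVec :=
  WithLp.toLp 2 ![∑ j : Fin 2, ((R (EuclideanSpace.single j 1) 0 : ℝ) : ℂ) * w j.castSucc,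
    ∑ j : Fin 2, ((R (EuclideanSpace.single j 1) 1 : ℝ) : ℂ) * w j.castSucc,
    w 2]

/-- The action `(O_g φ)(x) = ḡ φ(g⁻¹ x)` on vector fields. -/
def fieldAction (g : Plane ≃ᵃⁱ[ℝ] Plane) (φ : Space → CVec) (x : Space) : CVec :=
  rotate g.linearIsometryEquiv (φ (planeExtend g⁻¹ x))

/-! ### Differential operators and test functions -/

/-- The three coordinate directions of `ℝ³`. -/
def direction : Fin 3 → Space :=
  ![(EuclideanSpace.single 0 1, 0), (EuclideanSpace.single 1 1, 0), (0, 1)]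

/-- The partial derivative `∂_i f`. -/
def partialDeriv (i : Fin 3) (f : Space → ℂ) (x : Space) : ℂ :=
  fderiv ℝ f x (direction i)

/-- The divergence of a vector field. -/
def divergence (θ : Space → CVec) (x : Space) : ℂ :=
  ∑ i, partialDeriv i (fun y => θ y i) x

/-- The bilinear product `a · b = ∑ᵢ aᵢ bᵢ` on `ℂ³`, without conjugation. -/
def dot (a b : CVec) : ℂ := ∑ i, a i * b i

/-- Smooth compactly supported functions or fields on `ℝ³`. -/
def IsTest {E : Type*} [NormedAddCommGroup E] [NormedSpace ℝ E] (θ : Space → E) : Prop :=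
  ContDiff ℝ ((⊤ : ℕ∞) : WithTop ℕ∞) θ ∧ HasCompactSupport θ

/-- `div φ = 0` in the open set `D`, in the sense of distributions. -/
def IsDivFree (D : Set Space) (φ : Space → CVec) : Prop :=
  ∀ η : Space → ℂ, IsTest η → tsupport η ⊆ D →
    ∫ x in D, ∑ i, φ x i * partialDeriv i η x = 0

/-! ### The quasi-periodic Green's function and the potentials -/

/-- The square root on `ℂ` with branch cut along the negative imaginary axis. Every value at
`z ≠ 0` has positive real part or positive imaginary part; it is `√z` for `z > 0` and
`i √|z|` for `z < 0`. -/
def outgoingSqrt (z : ℂ) : ℂ :=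
  Complex.exp (Complex.I * (π / 4)) * (-Complex.I * z) ^ (1 / 2 : ℂ)

/-- The vertical wave number `β_q = √(ω² - |α + q|²)`. -/
def beta (α : Plane) (ω : ℂ) (q : Plane) : ℂ :=
  outgoingSqrt (ω ^ 2 - ((‖α + q‖ ^ 2 : ℝ) : ℂ))

/-- The exceptional set `Z(α) = {|α + q|² : q ∈ Λ*}`. -/
def threshold (v : Module.Basis (Fin 2) ℝ Plane) (α : Plane) : Set ℂ :=
  {z | ∃ q ∈ dualLattice v, z = ((‖α + q‖ ^ 2 : ℝ) : ℂ)}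

/-- The outgoing quasi-periodic Green's function
`G(x) = (1/2) ∑_{q ∈ Λ*} i β_q⁻¹ exp(i (α + q) · x') exp(i β_q |x₃|)`, where the series
converges absolutely for `x₃ ≠ 0`, that is, almost everywhere. -/
def green (v : Module.Basis (Fin 2) ℝ Plane) (α : Plane) (ω : ℂ) (x : Space) : ℂ :=
  1 / 2 * ∑' q : dualLattice v, Complex.I * (beta α ω q)⁻¹ *
    Complex.exp (Complex.I * ((inner ℝ (α + (q : Plane)) x.1 : ℝ) : ℂ)) *
    Complex.exp (Complex.I * beta α ω q * ((|x.2| : ℝ) : ℂ))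

/-- The vector potential `K[φ](x) = ∫_D G(x - y) φ(y) dy`. -/
def vectorPotential (v : Module.Basis (Fin 2) ℝ Plane) (D : Set Space) (α : Plane) (ω : ℂ)
    (φ : Space → CVec) (x : Space) : CVec :=
  ∫ y in D, green v α ω (x - y) • φ y

/-- The electric potential `T[φ] = (ω² + ∇ div) K[φ]`, as a distribution on `ℝ³`: its value
on the test field `θ` is `∫ K[φ] · (ω² θ + ∇ div θ)`. -/
def electricPotential (v : Module.Basis (Fin 2) ℝ Plane) (D : Set Space) (α : Plane) (ω : ℂ)
    (φ θ : Space → CVec) : ℂ :=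
  ∫ x, ∑ i, vectorPotential v D α ω φ x i *
    (ω ^ 2 * θ x i + partialDeriv i (divergence θ) x)

/-- `T[φ] = u` on `ℝ³`: the distribution `T[φ]` is the locally integrable field `u`. -/
def IsElectricPotential (v : Module.Basis (Fin 2) ℝ Plane) (D : Set Space) (α : Plane) (ω : ℂ)
    (φ u : Space → CVec) : Prop :=
  LocallyIntegrable u ∧
    ∀ θ : Space → CVec, IsTest θ →
      ∫ x, dot (u x) (θ x) = electricPotential v D α ω φ θ

/-! ### The operator `A_τ(α, ω)`, resonances and eigenfunctions -/

/-- `A_τ(α, ω) φ = ψ` in `D`, where `A_τ(α, ω) = τ⁻¹ - T`. Only the values of `φ` and `ψ`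
in `D` matter. -/
def OperatorGraph (v : Module.Basis (Fin 2) ℝ Plane) (D : Set Space) (τ : ℝ) (α : Plane)
    (ω : ℂ) (φ ψ : Space → CVec) : Prop :=
  ∃ u : Space → CVec, IsElectricPotential v D α ω φ u ∧
    ∀ᵐ x ∂volume.restrict D, ψ x = ((τ⁻¹ : ℝ) : ℂ) • φ x - u x

/-- A square integrable field times a derivative of a test function is integrable. -/
theorem integrable_mul_partialDeriv (D : Set Space) (f : Lp CVec 2 (volume.restrict D))
    (η : Space → ℂ) (hη : IsTest η) :
    Integrable (fun x => ∑ i, f x i * partialDeriv i η x) (volume.restrict D) := by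
  refine integrable_finsetSum _ fun i _ => ?_
  have h1 : MemLp (fun x => f x i) 2 (volume.restrict D) :=
    (EuclideanSpace.proj (𝕜 := ℂ) i).comp_memLp f
  have h2 : MemLp (partialDeriv i η) 2 (volume.restrict D) := by
    have hc : Continuous (partialDeriv i η) :=
      (hη.1.continuous_fderiv (by simp)).clm_apply continuous_const
    have hs : HasCompactSupport (partialDeriv i η) :=
      hη.2.fderiv_apply ℝ (direction i)
    exact (hc.memLp_of_hasCompactSupport hs)
  exact h1.integrable_mul h2

/-- The space `H(div 0, D)` of square integrable divergence-free fields in `D`, with the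
topology of `L²(D)`. -/
def divFreeSpace (D : Set Space) : Submodule ℂ (Lp CVec 2 (volume.restrict D)) where
  carrier := {f | IsDivFree D f}
  zero_mem' := by
    intro η _ _
    have h : ∀ᵐ x ∂volume.restrict D,
        ∑ i, (0 : Lp CVec 2 (volume.restrict D)) x i * partialDeriv i η x = 0 := by
      filter_upwards [Lp.coeFn_zero CVec 2 (volume.restrict D)] with x hx
      have hx0 : (0 : Lp CVec 2 (volume.restrict D)) x = 0 := hx
      rw [hx0]
      simp
    rw [integral_congr_ae h]
    simp
  add_mem' := by
    intro f g hf hg η hη hs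
    have h : ∀ᵐ x ∂volume.restrict D,
        ∑ i, (f + g) x i * partialDeriv i η x
          = ∑ i, f x i * partialDeriv i η x + ∑ i, g x i * partialDeriv i η x := by
      filter_upwards [Lp.coeFn_add f g] with x hx
      rw [hx, ← Finset.sum_add_distrib]
      simp [add_mul]
    rw [integral_congr_ae h, integral_add (integrable_mul_partialDeriv D f η hη)
      (integrable_mul_partialDeriv D g η hη), hf η hη hs, hg η hη hs, add_zero]
  smul_mem' := by
    intro c f hf η hη hs
    have h : ∀ᵐ x ∂volume.restrict D,
        ∑ i, (c • f) x i * partialDeriv i η x = c * ∑ i, f x i * partialDeriv i η x := by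
      filter_upwards [Lp.coeFn_smul c f] with x hx
      rw [hx, Finset.mul_sum]
      simp [mul_assoc]
    rw [integral_congr_ae h, integral_const_mul, hf η hη hs, mul_zero]

/-- `A_τ(α, ω)` is invertible on `H(div 0, D)`: it is a linear bijection of this space onto
itself that is bounded and has a bounded inverse. -/
def IsInvertible (v : Module.Basis (Fin 2) ℝ Plane) (D : Set Space) (τ : ℝ) (α : Plane)
    (ω : ℂ) : Prop :=
  ∃ B : divFreeSpace D ≃L[ℂ] divFreeSpace D, ∀ φ : divFreeSpace D,
    OperatorGraph v D τ α ω (φ : Lp CVec 2 (volume.restrict D))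
      (B φ : Lp CVec 2 (volume.restrict D))

/-- The scattering resonances at quasi-momentum `α`: the `ω ∈ ℂ` with `ω² ∉ Z(α)` for which
`A_τ(α, ω)` is not invertible. -/
def resonances (v : Module.Basis (Fin 2) ℝ Plane) (D : Set Space) (τ : ℝ) (α : Plane) : Set ℂ :=
  {ω | ω ^ 2 ∉ threshold v α ∧ ¬ IsInvertible v D τ α ω}

/-- The geometric multiplicity `dim ker A_τ(α, ω)`. The kernel is a linear subspace, so it is
its own linear span. -/
def geometricMultiplicity (v : Module.Basis (Fin 2) ℝ Plane) (D : Set Space) (τ : ℝ) (α : Plane)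
    (ω : ℂ) : ℕ∞ :=
  Cardinal.toENat (Module.rank ℂ (Submodule.span ℂ
    {φ : divFreeSpace D |
      OperatorGraph v D τ α ω (φ : Lp CVec 2 (volume.restrict D)) (fun _ => 0)}))

/-- The resonances at `α`, each repeated according to its multiplicity: copies of `ω` are
numbered by `k < geometricMultiplicity`. -/
def resonanceCopies (v : Module.Basis (Fin 2) ℝ Plane) (D : Set Space) (τ : ℝ) (α : Plane) :
    Set (ℂ × ℕ) :=
  {p | p.1 ∈ resonances v D τ α ∧ (p.2 : ℕ∞) < geometricMultiplicity v D τ α p.1}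

/-- `z` is the `j`-th (`j ≥ 0`) resonance at `α`, counted with multiplicity, in the total
order `lt` on `ℂ`: exactly `j` copies of resonances come before some copy of `z`. -/
def IsBandValue (v : Module.Basis (Fin 2) ℝ Plane) (D : Set Space) (τ : ℝ)
    (lt : ℂ → ℂ → Prop) (j : ℕ) (α : Plane) (z : ℂ) : Prop :=
  ∃ k : ℕ, (z, k) ∈ resonanceCopies v D τ α ∧
    {p ∈ resonanceCopies v D τ α | lt p.1 z ∨ (p.1 = z ∧ p.2 < k)}.encard = j

/-- There is at most one `j`-th resonance. -/
theorem IsBandValue.unique {v : Module.Basis (Fin 2) ℝ Plane} {D : Set Space} {τ : ℝ}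
    {lt : ℂ → ℂ → Prop} [IsStrictTotalOrder ℂ lt] {j : ℕ} {α : Plane} {z w : ℂ}
    (hz : IsBandValue v D τ lt j α z) (hw : IsBandValue v D τ lt j α w) : z = w := by
  have key : ∀ z w : ℂ, IsBandValue v D τ lt j α z → IsBandValue v D τ lt j α w →
      ¬ lt z w := by
    rintro z w ⟨k, hk, hkj⟩ ⟨l, _, hlj⟩ hlt
    have hss : {p ∈ resonanceCopies v D τ α | lt p.1 z ∨ (p.1 = z ∧ p.2 < k)} ⊂
        {p ∈ resonanceCopies v D τ α | lt p.1 w ∨ (p.1 = w ∧ p.2 < l)} := by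
      refine ⟨?_, fun h => ?_⟩
      · rintro p ⟨hp, hp' | ⟨hp', _⟩⟩
        · exact ⟨hp, Or.inl (_root_.trans hp' hlt)⟩
        · exact ⟨hp, Or.inl (hp' ▸ hlt)⟩
      · rcases (h ⟨hk, Or.inl hlt⟩ : (z, k) ∈ _).2 with h' | h'
        · exact irrefl z h'
        · exact lt_irrefl k h'.2
    have hfin := Set.finite_of_encard_eq_coe hkj
    have := hfin.encard_lt_encard hss
    rw [hkj, hlj] at this
    exact lt_irrefl _ this
  rcases trichotomous_of lt z w with h | h | h
  · exact (key z w hz hw h).elim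
  · exact h
  · exact (key w z hw hz h).elim

open Classical in
/-- The band dispersion function `ω_j(α)`: the `j`-th resonance at `α`, if there is one.
The order `lt` on `ℂ` that numbers the resonances is, for instance, the one by increasing
modulus, with ties broken by the argument. -/
def bandFunction (v : Module.Basis (Fin 2) ℝ Plane) (D : Set Space) (τ : ℝ)
    (lt : ℂ → ℂ → Prop) (j : ℕ) (α : Plane) : Option ℂ :=
  if h : ∃ z, IsBandValue v D τ lt j α z then some h.choose else none

/-- The quasi-periodic extension `∑_{γ ∈ Λ} (f χ_D)(x - (γ, 0)) exp(i α · γ)`. -/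
def quasiPeriodicExtension (v : Module.Basis (Fin 2) ℝ Plane) (D : Set Space) (α : Plane)
    (f : Space → CVec) (x : Space) : CVec :=
  ∑' γ : lattice v, Complex.exp (Complex.I * ((inner ℝ α (γ : Plane) : ℝ) : ℂ)) •
    D.indicator f (x - (((γ : Plane), 0) : Space))

/-- The space `L²_α(D)` of the quasi-periodic extensions of the fields in `L²(D)`. -/
def MemL2Quasi (v : Module.Basis (Fin 2) ℝ Plane) (D : Set Space) (α : Plane)
    (φ : Space → CVec) : Prop :=
  ∃ f : Space → CVec, MemLp f 2 (volume.restrict D) ∧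
    ∀ᵐ x, φ x = quasiPeriodicExtension v D α f x

/-- `φ ∈ L²_α(D)` is an eigenfunction of `A_τ(α, ω)`: it is nonzero, divergence-free in `D`,
and `A_τ(α, ω) φ = 0`. -/
def IsEigenfunction (v : Module.Basis (Fin 2) ℝ Plane) (D : Set Space) (τ : ℝ) (α : Plane)
    (ω : ℂ) (φ : Space → CVec) : Prop :=
  MemL2Quasi v D α φ ∧ ¬ (∀ᵐ x, φ x = 0) ∧ IsDivFree D φ ∧
    OperatorGraph v D τ α ω φ (fun _ => 0)

end

end Metasurface

open Metasurface

namespace Metasurface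

noncomputable section

/-! ### The action of an orthogonal map on `ℂ³` -/

/-! Everything rests on covariance of the potential under a symmetry `g` with linear part `R`.
Conjugating a translation by `g` turns its vector `a` into `R a`, so `R` permutes `Λ`, hence also
`Λ*`, and preserves the thresholds and the Brillouin zone. Reindexing the series by `R` gives
`G^{Rα}(R x', x₃) = G^α(x)` (`PreservesLattice.green_apply`).

The difficulty is that `g` preserves the metasurface but not the single scatterer `D`, over which
the integrals run. However, `D` and `g⁻¹(D)` are both fundamental domains for the action of `Λ` on
the metasurface, and `y ↦ G(x - y) φ(y)` is `Λ`-periodic when `φ` is quasi-periodic with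
quasi-momentum `α`, because the phases cancel. The two integrals therefore agree, and the vector
potential is covariant (`IsSymmetry.vectorPotential_fieldAction`). Since `ω² + ∇ div` commutes with
orthogonal changes of coordinates, its action on test fields gives the covariance of the electric
potential (`IsSymmetry.electricPotential_fieldAction`), which is claim (3).

For the operator, a field on `D` is extended quasi-periodically, moved by `g`, and restricted to `D`
again. This is an isometric automorphism of `H(div 0, D)` (`IsSymmetry.divFreeEquiv`) whose inverse
comes from `g⁻¹` at quasi-momentum `Rα`. It carries the graph of `A_τ(α, ω)` to that of `A_τ(Rα, ω)`
(`IsSymmetry.operatorGraph_divFreeAction`). Invertibility, kernel dimensions and band functions then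
agree, and eigenfunctions are transported by the same covariance.

Two points are local to `D` and have to be spread over the metasurface first: the equation defining
the operator, by quasi-periodicity of the potential itself (`IsElectricPotential.ae_add`), and the
divergence condition, by splitting test functions among the translates
(`IsQuasiPeriodic.isDivFree_metasurface`). -/

theorem apply_eq_sum (R : Plane ≃ₗᵢ[ℝ] Plane) (x : Plane) (i : Fin 2) :
    R x i = ∑ j, x j * R (EuclideanSpace.single j 1) i := by
  have hx : x = ∑ j, x j • EuclideanSpace.single j (1 : ℝ) := by
    ext k; fin_cases k <;> simp
  conv_lhs => rw [hx]
  rw [map_sum]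
  simp

/-- The columns of an orthogonal map are orthonormal. -/
theorem sum_column_mul_column (R : Plane ≃ₗᵢ[ℝ] Plane) (j k : Fin 2) :
    ∑ i, R (EuclideanSpace.single j 1) i * R (EuclideanSpace.single k 1) i
      = if j = k then 1 else 0 := by
  have h := R.inner_map_map (EuclideanSpace.single k (1 : ℝ)) (EuclideanSpace.single j 1)
  rw [EuclideanSpace.inner_single_left] at h
  rw [PiLp.inner_apply] at h
  simp only [RCLike.inner_apply, conj_trivial] at h
  rw [h, PiLp.single_apply]
  simp [eq_comm]

/-- The matrix of the inverse is the transpose. -/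
theorem inv_apply_single (R : Plane ≃ₗᵢ[ℝ] Plane) (i j : Fin 2) :
    R⁻¹ (EuclideanSpace.single i 1) j = R (EuclideanSpace.single j 1) i := by
  have h := R.inner_map_map (R⁻¹ (EuclideanSpace.single i (1 : ℝ))) (EuclideanSpace.single j 1)
  have h2 : R (R⁻¹ (EuclideanSpace.single i (1 : ℝ))) = EuclideanSpace.single i 1 :=
    R.apply_symm_apply _
  rw [h2, EuclideanSpace.inner_single_left, EuclideanSpace.inner_single_right] at h
  simpa using h.symm

/-- The map `rotate R` as a linear map. -/
def rotateLinear (R : Plane ≃ₗᵢ[ℝ] Plane) : CVec →ₗ[ℂ] CVec where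
  toFun := rotate R
  map_add' a b := by
    ext i; fin_cases i <;> simp [rotate] <;> ring
  map_smul' c a := by
    ext i; fin_cases i <;> simp [rotate] <;> ring

theorem rotate_zero (R : Plane ≃ₗᵢ[ℝ] Plane) : rotate R 0 = 0 := (rotateLinear R).map_zero

theorem rotate_add (R : Plane ≃ₗᵢ[ℝ] Plane) (a b : CVec) :
    rotate R (a + b) = rotate R a + rotate R b := (rotateLinear R).map_add a b

theorem rotate_smul (R : Plane ≃ₗᵢ[ℝ] Plane) (c : ℂ) (a : CVec) :
    rotate R (c • a) = c • rotate R a := (rotateLinear R).map_smul c a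

theorem rotate_one (w : CVec) : rotate 1 w = w := by
  ext i; fin_cases i <;> simp [rotate]

theorem rotate_mul (R S : Plane ≃ₗᵢ[ℝ] Plane) (w : CVec) :
    rotate (R * S) w = rotate R (rotate S w) := by
  have h (i j) : R (S (EuclideanSpace.single j 1)) i = ∑ k, S (EuclideanSpace.single j 1) k *
      R (EuclideanSpace.single k 1) i := apply_eq_sum R _ i
  ext i
  fin_cases i <;> simp [rotate, h] <;> ring

theorem dot_rotate (R : Plane ≃ₗᵢ[ℝ] Plane) (a b : CVec) :
    dot (rotate R a) (rotate R b) = dot a b := by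
  have h (j k : Fin 2) : ∑ i, ((R (EuclideanSpace.single j 1) i : ℝ) : ℂ) *
      ((R (EuclideanSpace.single k 1) i : ℝ) : ℂ) = if j = k then 1 else 0 := by
    have := congrArg (fun t : ℝ => (t : ℂ)) (sum_column_mul_column R j k)
    push_cast at this
    rw [this]
    split_ifs <;> simp
  have h00 := h 0 0
  have h01 := h 0 1
  have h11 := h 1 1
  simp only [Fin.sum_univ_two, Fin.isValue, if_true, zero_ne_one, if_false] at h00 h01 h11
  simp only [dot, rotate, Fin.sum_univ_three, Fin.sum_univ_two, Fin.isValue, Fin.castSucc_zero,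
    Fin.castSucc_one, Matrix.cons_val]
  -- The coefficient of `a j * b k` is the inner product of columns `j` and `k`; the two mixed terms
  -- share the relation `h01`.
  linear_combination (a 0 * b 0) * h00 + (a 0 * b 1 + a 1 * b 0) * h01 + (a 1 * b 1) * h11

/-- The squared norm is the bilinear product of `w` with its conjugate, and a real matrix commutes
with conjugation, so `dot_rotate` applies. -/
theorem norm_rotate (R : Plane ≃ₗᵢ[ℝ] Plane) (w : CVec) : ‖rotate R w‖ = ‖w‖ := by
  have hnorm (w : CVec) : ((‖w‖ ^ 2 : ℝ) : ℂ) = dot w (WithLp.toLp 2 fun i => star (w i)) := by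
    rw [EuclideanSpace.norm_sq_eq]
    simp [dot, Complex.mul_conj']
  have hstar : (WithLp.toLp 2 fun i => star (rotate R w i) : CVec) =
      rotate R (WithLp.toLp 2 fun i => star (w i)) := by
    ext i; fin_cases i <;> simp [rotate]
  have h : ((‖rotate R w‖ ^ 2 : ℝ) : ℂ) = ((‖w‖ ^ 2 : ℝ) : ℂ) := by
    rw [hnorm, hnorm, hstar, dot_rotate]
  exact (sq_eq_sq₀ (norm_nonneg _) (norm_nonneg _)).1 (by exact_mod_cast h)

/-- The map `rotate R` as an isometry. -/
def rotateIsometry (R : Plane ≃ₗᵢ[ℝ] Plane) : CVec →ₗᵢ[ℂ] CVec :=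
  ⟨rotateLinear R, norm_rotate R⟩

theorem continuous_rotate (R : Plane ≃ₗᵢ[ℝ] Plane) : Continuous (rotate R) :=
  (rotateIsometry R).continuous

/-! ### The action of a plane isometry on space -/

theorem isometry_apply (g : Plane ≃ᵃⁱ[ℝ] Plane) (x : Plane) :
    g x = g.linearIsometryEquiv x + g 0 := by
  simpa using g.map_vadd 0 x

theorem isometry_add (g : Plane ≃ᵃⁱ[ℝ] Plane) (x y : Plane) :
    g (x + y) = g x + g.linearIsometryEquiv y := by
  rw [add_comm x y, add_comm (g x)]
  exact g.map_vadd x y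

theorem linear_mul (g h : Plane ≃ᵃⁱ[ℝ] Plane) :
    (g * h).linearIsometryEquiv = g.linearIsometryEquiv * h.linearIsometryEquiv := by
  ext1 x
  have h1 := isometry_add (g * h) 0 x
  have h2 : (g * h) (0 + x) = g (h (0 + x)) := rfl
  have h3 : (g * h) 0 = g (h 0) := rfl
  rw [h2, h3, isometry_add h, isometry_add g] at h1
  exact (add_left_cancel h1).symm

theorem linear_one : (1 : Plane ≃ᵃⁱ[ℝ] Plane).linearIsometryEquiv = 1 := rfl

theorem linear_inv (g : Plane ≃ᵃⁱ[ℝ] Plane) :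
    g⁻¹.linearIsometryEquiv = g.linearIsometryEquiv⁻¹ := by
  rw [eq_inv_iff_mul_eq_one, ← linear_mul, inv_mul_cancel, linear_one]

theorem planeExtend_mul (g h : Plane ≃ᵃⁱ[ℝ] Plane) (x : Space) :
    planeExtend (g * h) x = planeExtend g (planeExtend h x) := rfl

theorem planeExtend_one (x : Space) : planeExtend 1 x = x := rfl

theorem planeExtend_inv_apply (g : Plane ≃ᵃⁱ[ℝ] Plane) (x : Space) :
    planeExtend g⁻¹ (planeExtend g x) = x := by
  rw [← planeExtend_mul, inv_mul_cancel, planeExtend_one]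

theorem planeExtend_apply_inv (g : Plane ≃ᵃⁱ[ℝ] Plane) (x : Space) :
    planeExtend g (planeExtend g⁻¹ x) = x := by
  rw [← planeExtend_mul, mul_inv_cancel, planeExtend_one]

theorem planeExtend_add (g : Plane ≃ᵃⁱ[ℝ] Plane) (x : Space) (a : Plane) :
    planeExtend g (x + (a, 0)) = planeExtend g x + (g.linearIsometryEquiv a, 0) := by
  refine Prod.ext (isometry_add g x.1 a) ?_
  simp [planeExtend]

theorem planeExtend_sub (g : Plane ≃ᵃⁱ[ℝ] Plane) (x : Space) (a : Plane) :
    planeExtend g (x - (a, 0)) = planeExtend g x - (g.linearIsometryEquiv a, 0) := by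
  rw [eq_sub_iff_add_eq, ← planeExtend_add, sub_add_cancel]

theorem continuous_planeExtend (g : Plane ≃ᵃⁱ[ℝ] Plane) : Continuous (planeExtend g) :=
  (g.continuous.comp continuous_fst).prodMk continuous_snd

/-- The extension of a plane isometry, as a homeomorphism of space. -/
def planeHomeo (g : Plane ≃ᵃⁱ[ℝ] Plane) : Space ≃ₜ Space where
  toFun := planeExtend g
  invFun := planeExtend g⁻¹
  left_inv := planeExtend_inv_apply g
  right_inv := planeExtend_apply_inv g
  continuous_toFun := continuous_planeExtend g
  continuous_invFun := continuous_planeExtend g⁻¹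

theorem measurePreserving_planeExtend (g : Plane ≃ᵃⁱ[ℝ] Plane) :
    MeasurePreserving (planeExtend g) := by
  have h1 : MeasurePreserving (g : Plane → Plane) := by
    have h := (measurePreserving_add_right (volume : Measure Plane) (g 0)).comp
      g.linearIsometryEquiv.measurePreserving
    rwa [show (fun x => x + g 0) ∘ g.linearIsometryEquiv = (g : Plane → Plane) from
      funext fun x => (isometry_apply g x).symm] at h
  exact h1.prod (MeasurePreserving.id volume)

theorem measurableEmbedding_planeExtend (g : Plane ≃ᵃⁱ[ℝ] Plane) :
    MeasurableEmbedding (planeExtend g) :=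
  (planeHomeo g).measurableEmbedding

theorem contDiff_planeExtend (g : Plane ≃ᵃⁱ[ℝ] Plane) {n : WithTop ℕ∞} :
    ContDiff ℝ n (planeExtend g) := by
  have h : planeExtend g = fun x : Space => (g.linearIsometryEquiv x.1 + g 0, x.2) := by
    funext x
    exact Prod.ext (isometry_apply g x.1) rfl
  rw [h]
  exact ((g.linearIsometryEquiv.contDiff.comp contDiff_fst).add contDiff_const).prodMk contDiff_snd

/-! ### The action on fields -/

theorem fieldAction_mul (g h : Plane ≃ᵃⁱ[ℝ] Plane) (φ : Space → CVec) :
    fieldAction g (fieldAction h φ) = fieldAction (g * h) φ := by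
  funext x
  rw [fieldAction, fieldAction, fieldAction, linear_mul, rotate_mul, mul_inv_rev, planeExtend_mul]

theorem fieldAction_one (φ : Space → CVec) : fieldAction 1 φ = φ := by
  funext x
  rw [fieldAction, linear_one, rotate_one, inv_one, planeExtend_one]

theorem fieldAction_inv_fieldAction (g : Plane ≃ᵃⁱ[ℝ] Plane) (φ : Space → CVec) :
    fieldAction g⁻¹ (fieldAction g φ) = φ := by
  rw [fieldAction_mul, inv_mul_cancel, fieldAction_one]

theorem fieldAction_fieldAction_inv (g : Plane ≃ᵃⁱ[ℝ] Plane) (φ : Space → CVec) :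
    fieldAction g (fieldAction g⁻¹ φ) = φ := by
  rw [fieldAction_mul, mul_inv_cancel, fieldAction_one]

theorem fieldAction_planeExtend (g : Plane ≃ᵃⁱ[ℝ] Plane) (φ : Space → CVec) (x : Space) :
    fieldAction g φ (planeExtend g x) = rotate g.linearIsometryEquiv (φ x) := by
  rw [fieldAction, planeExtend_inv_apply]

theorem IsTest.fieldAction {θ : Space → CVec} (hθ : IsTest θ) (g : Plane ≃ᵃⁱ[ℝ] Plane) :
    IsTest (fieldAction g θ) := by
  refine ⟨?_, ?_⟩
  · exact ((rotateLinear g.linearIsometryEquiv).toContinuousLinearMap.restrictScalars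
      ℝ).contDiff.comp (hθ.1.comp (contDiff_planeExtend g⁻¹))
  · exact (hθ.2.comp_homeomorph (planeHomeo g).symm).comp_left
      (g := rotate g.linearIsometryEquiv) (rotate_zero _)

theorem locallyIntegrable_fieldAction {u : Space → CVec} (hu : LocallyIntegrable u)
    (g : Plane ≃ᵃⁱ[ℝ] Plane) : LocallyIntegrable (fieldAction g u) := by
  have h : LocallyIntegrable (u ∘ planeExtend g⁻¹) := by
    have := (locallyIntegrable_map_homeomorph (planeHomeo g⁻¹) (f := u) (μ := volume)).1
    rw [show Measure.map (planeHomeo g⁻¹) volume = (volume : Measure Space) from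
      (measurePreserving_planeExtend g⁻¹).map_eq] at this
    exact this hu
  exact h.mono ((continuous_rotate _).comp_aestronglyMeasurable h.aestronglyMeasurable)
    (.of_forall fun x => (norm_rotate _ _).le)

theorem locallyIntegrable_fieldAction_iff (g : Plane ≃ᵃⁱ[ℝ] Plane) (u : Space → CVec) :
    LocallyIntegrable (fieldAction g u) ↔ LocallyIntegrable u :=
  ⟨fun h => fieldAction_inv_fieldAction g u ▸ locallyIntegrable_fieldAction h g⁻¹,
    fun h => locallyIntegrable_fieldAction h g⟩

theorem integral_comp_planeExtend {E : Type*} [NormedAddCommGroup E] [NormedSpace ℝ E]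
    (g : Plane ≃ᵃⁱ[ℝ] Plane) (f : Space → E) : ∫ x, f (planeExtend g x) = ∫ x, f x :=
  (measurePreserving_planeExtend g).integral_comp (measurableEmbedding_planeExtend g) f

theorem integral_dot_fieldAction (g : Plane ≃ᵃⁱ[ℝ] Plane) (u θ : Space → CVec) :
    ∫ x, dot (fieldAction g u x) (fieldAction g θ x) = ∫ x, dot (u x) (θ x) := by
  rw [← integral_comp_planeExtend g]
  simp only [fieldAction_planeExtend, dot_rotate]

/-! ### Derivatives under the action -/

/-- The gradient of a function, as a vector field. -/
def gradient (f : Space → ℂ) (x : Space) : CVec := WithLp.toLp 2 fun i => partialDeriv i f x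

/-- No differentiability is needed: composition with an invertible affine map preserves
differentiability both ways, so the default value `0` of `fderiv` is respected. -/
theorem fderiv_comp_planeExtend (g : Plane ≃ᵃⁱ[ℝ] Plane) (f : Space → ℂ) (x d : Space) :
    fderiv ℝ (fun y => f (planeExtend g y)) x d
      = fderiv ℝ f (planeExtend g x) (g.linearIsometryEquiv d.1, d.2) := by
  let L : Space ≃L[ℝ] Space :=
    g.linearIsometryEquiv.toContinuousLinearEquiv.prodCongr (ContinuousLinearEquiv.refl ℝ ℝ)
  have h (y : Space) : planeExtend g y = L y + (g 0, 0) :=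
    Prod.ext (isometry_apply g y.1) (add_zero y.2).symm
  have h2 : (fun y => f (planeExtend g y)) = (fun y => f (y + (g 0, 0))) ∘ L := by
    funext y; simp [h]
  rw [h2, L.comp_right_fderiv, ContinuousLinearMap.comp_apply, fderiv_comp_add_right, h]
  rfl

theorem gradient_comp_planeExtend_inv (g : Plane ≃ᵃⁱ[ℝ] Plane) (f : Space → ℂ) (x : Space) :
    gradient (fun y => f (planeExtend g⁻¹ y)) x
      = rotate g.linearIsometryEquiv (gradient f (planeExtend g⁻¹ x)) := by
  -- The inverse matrix is the transpose, so the image of `e_i` under the inverse has row `i` of the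
  -- matrix as its coordinates.
  have hs (i : Fin 2) : (((g⁻¹).linearIsometryEquiv (EuclideanSpace.single i 1), (0 : ℝ)) : Space) =
      g.linearIsometryEquiv (EuclideanSpace.single 0 1) i • direction 0 +
      g.linearIsometryEquiv (EuclideanSpace.single 1 1) i • direction 1 := by
    rw [linear_inv]
    refine Prod.ext ?_ (by simp [direction])
    ext k
    rw [inv_apply_single]
    fin_cases k <;> simp [direction]
  ext i
  simp only [gradient, partialDeriv, fderiv_comp_planeExtend]
  fin_cases i
  · change fderiv ℝ f _ ((g⁻¹).linearIsometryEquiv (EuclideanSpace.single 0 1), (0 : ℝ)) = _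
    rw [hs 0, map_add, map_smul, map_smul]
    simp [rotate]
  · change fderiv ℝ f _ ((g⁻¹).linearIsometryEquiv (EuclideanSpace.single 1 1), (0 : ℝ)) = _
    rw [hs 1, map_add, map_smul, map_smul]
    simp [rotate]
  · simp [rotate, direction]

/-- The Jacobian is conjugated by an orthogonal matrix, which leaves its trace unchanged.
Differentiability is used to split the derivatives of the rotated components. -/
theorem divergence_fieldAction (g : Plane ≃ᵃⁱ[ℝ] Plane) {θ : Space → CVec}
    (hθ : Differentiable ℝ θ) (x : Space) :
    divergence (fieldAction g θ) x = divergence θ (planeExtend g⁻¹ x) := by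
  set R := g.linearIsometryEquiv with hR
  have hd (j : Fin 3) : Differentiable ℝ fun y => θ (planeExtend g⁻¹ y) j :=
    ((EuclideanSpace.proj (𝕜 := ℂ) j).restrictScalars ℝ).differentiable.comp
      (hθ.comp ((contDiff_planeExtend g⁻¹ (n := 1)).differentiable one_ne_zero))
  have hpd (i j : Fin 3) : partialDeriv i (fun y => θ (planeExtend g⁻¹ y) j) x =
      rotate R (gradient (fun y => θ y j) (planeExtend g⁻¹ x)) i :=
    congrArg (fun w : CVec => w i) (gradient_comp_planeExtend_inv g (fun y => θ y j) x)
  have hlin (i : Fin 3) (c d : ℂ) (j k : Fin 3) : partialDeriv i (fun y =>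
      c * θ (planeExtend g⁻¹ y) j + d * θ (planeExtend g⁻¹ y) k) x =
      c * partialDeriv i (fun y => θ (planeExtend g⁻¹ y) j) x +
      d * partialDeriv i (fun y => θ (planeExtend g⁻¹ y) k) x := by
    rw [partialDeriv, fderiv_fun_add ((hd j x).const_mul c) ((hd k x).const_mul d),
      fderiv_const_mul (hd j x), fderiv_const_mul (hd k x)]
    rfl
  have h0 : (fun y => fieldAction g θ y 0) = fun y =>
      ((R (EuclideanSpace.single 0 1) 0 : ℝ) : ℂ) * θ (planeExtend g⁻¹ y) 0 +
      ((R (EuclideanSpace.single 1 1) 0 : ℝ) : ℂ) * θ (planeExtend g⁻¹ y) 1 := by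
    funext y; simp [fieldAction, rotate, hR]
  have h1 : (fun y => fieldAction g θ y 1) = fun y =>
      ((R (EuclideanSpace.single 0 1) 1 : ℝ) : ℂ) * θ (planeExtend g⁻¹ y) 0 +
      ((R (EuclideanSpace.single 1 1) 1 : ℝ) : ℂ) * θ (planeExtend g⁻¹ y) 1 := by
    funext y; simp [fieldAction, rotate, hR]
  have h2 : (fun y => fieldAction g θ y 2) = fun y => θ (planeExtend g⁻¹ y) 2 := by
    funext y; simp [fieldAction, rotate]
  rw [divergence, divergence, Fin.sum_univ_three, Fin.sum_univ_three, h0, h1, h2, hlin, hlin]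
  simp only [hpd]
  have e00 := sum_column_mul_column R 0 0
  have e01 := sum_column_mul_column R 0 1
  have e11 := sum_column_mul_column R 1 1
  simp only [Fin.sum_univ_two, Fin.isValue, if_true, zero_ne_one, if_false] at e00 e01 e11
  replace e00 := congrArg (fun t : ℝ => (t : ℂ)) e00
  replace e01 := congrArg (fun t : ℝ => (t : ℂ)) e01
  replace e11 := congrArg (fun t : ℝ => (t : ℂ)) e11
  push_cast at e00 e01 e11
  simp only [rotate, gradient, Fin.sum_univ_two, Fin.isValue, Fin.castSucc_zero,
    Fin.castSucc_one, Matrix.cons_val]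
  set p := planeExtend g⁻¹ x
  linear_combination (partialDeriv 0 (fun y => θ y 0) p) * e00 +
    (partialDeriv 1 (fun y => θ y 0) p + partialDeriv 0 (fun y => θ y 1) p) * e01 +
    (partialDeriv 1 (fun y => θ y 1) p) * e11

/-! ### The lattice under the symmetry group -/

/-- The conjugate of translation by `a` under `g` is translation by the rotated vector and again
lies in the symmetry group. That the group contains no translations beyond `Λ` puts this vector in
the lattice. -/
theorem linear_mem_lattice {v : Module.Basis (Fin 2) ℝ Plane} {D : Set Space}
    (hΛ : translationVectors v D = (lattice v : Set Plane)) {g : Plane ≃ᵃⁱ[ℝ] Plane}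
    (hg : g ∈ symmetryGroup v D) {a : Plane} (ha : a ∈ lattice v) :
    g.linearIsometryEquiv a ∈ lattice v := by
  have ha' : a ∈ translationVectors v D := hΛ ▸ ha
  have hmem := mul_mem (mul_mem hg ha') (inv_mem hg)
  have hconj : g * AffineIsometryEquiv.constVAdd ℝ Plane a * g⁻¹ =
      AffineIsometryEquiv.constVAdd ℝ Plane (g.linearIsometryEquiv a) := by
    ext1 x
    change g (a + g⁻¹ x) = g.linearIsometryEquiv a + x
    rw [add_comm, isometry_add, add_comm]
    exact congrArg _ (g.apply_symm_apply x)
  rw [hconj] at hmem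
  have : g.linearIsometryEquiv a ∈ translationVectors v D := hmem
  rwa [hΛ] at this

/-- An orthogonal map of the plane preserves the lattice. -/
def PreservesLattice (v : Module.Basis (Fin 2) ℝ Plane) (R : Plane ≃ₗᵢ[ℝ] Plane) : Prop :=
  ∀ a, R a ∈ lattice v ↔ a ∈ lattice v

theorem preservesLattice_linear {v : Module.Basis (Fin 2) ℝ Plane} {D : Set Space}
    (hΛ : translationVectors v D = (lattice v : Set Plane)) {g : Plane ≃ᵃⁱ[ℝ] Plane}
    (hg : g ∈ symmetryGroup v D) : PreservesLattice v g.linearIsometryEquiv := by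
  refine fun a => ⟨fun h => ?_, linear_mem_lattice hΛ hg⟩
  have := linear_mem_lattice hΛ (inv_mem hg) h
  rw [linear_inv] at this
  have h2 : g.linearIsometryEquiv⁻¹ (g.linearIsometryEquiv a) = a :=
    g.linearIsometryEquiv.symm_apply_apply a
  rwa [h2] at this

namespace PreservesLattice

variable {v : Module.Basis (Fin 2) ℝ Plane} {R : Plane ≃ₗᵢ[ℝ] Plane}

theorem apply_mem_dualLattice_iff (hR : PreservesLattice v R) (q : Plane) :
    R q ∈ dualLattice v ↔ q ∈ dualLattice v := by
  constructor
  · intro h γ hγ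
    obtain ⟨n, hn⟩ := h (R γ) ((hR γ).2 hγ)
    exact ⟨n, by rw [← hn, R.inner_map_map]⟩
  · intro h γ hγ
    obtain ⟨n, hn⟩ := h (R.symm γ) ((hR _).1 (by rwa [R.apply_symm_apply]))
    exact ⟨n, by rw [← hn, ← R.inner_map_map q, R.apply_symm_apply]⟩

/-- The permutation of the reciprocal lattice induced by an orthogonal map that preserves the
lattice. -/
def dualLatticeEquiv (hR : PreservesLattice v R) : dualLattice v ≃ dualLattice v :=
  R.toEquiv.subtypeEquiv fun q => (hR.apply_mem_dualLattice_iff q).symm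

theorem coe_dualLatticeEquiv (hR : PreservesLattice v R) (q : dualLattice v) :
    (hR.dualLatticeEquiv q : Plane) = R q := rfl

theorem apply_mem_brillouinZone (hR : PreservesLattice v R) {α : Plane}
    (hα : α ∈ brillouinZone v) : R α ∈ brillouinZone v := by
  intro q hq
  have h := hα (R.symm q) ((hR.apply_mem_dualLattice_iff _).1 (by rwa [R.apply_symm_apply]))
  rwa [← R.norm_map α, ← R.norm_map (α - R.symm q), map_sub, R.apply_symm_apply] at h

theorem threshold_apply (hR : PreservesLattice v R) (α : Plane) :
    threshold v (R α) = threshold v α := by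
  ext z
  constructor
  · rintro ⟨q, hq, rfl⟩
    refine ⟨R.symm q, (hR.apply_mem_dualLattice_iff _).1 (by rwa [R.apply_symm_apply]), ?_⟩
    rw [← R.norm_map (α + R.symm q), map_add, R.apply_symm_apply]
  · rintro ⟨q, hq, rfl⟩
    refine ⟨R q, (hR.apply_mem_dualLattice_iff _).2 hq, ?_⟩
    rw [← map_add, R.norm_map]

/-- The substitution `q ↦ R q` permutes the reciprocal lattice, and each term depends only on norms
and inner products. Reindexing by a bijection requires no summability. -/
theorem green_apply (hR : PreservesLattice v R) (α : Plane) (ω : ℂ) (x : Space) :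
    green v (R α) ω (R x.1, x.2) = green v α ω x := by
  rw [green, green, ← hR.dualLatticeEquiv.tsum_eq]
  simp only [hR.coe_dualLatticeEquiv, beta, ← map_add, R.norm_map, R.inner_map_map]

end PreservesLattice

/-! ### Quasi-periodicity -/

/-- The phase factor `exp(i α · γ)`. -/
def phase (α γ : Plane) : ℂ := Complex.exp (Complex.I * ((inner ℝ α γ : ℝ) : ℂ))

theorem phase_zero (α : Plane) : phase α 0 = 1 := by simp [phase]

theorem phase_add (α γ δ : Plane) : phase α (γ + δ) = phase α γ * phase α δ := by
  rw [phase, phase, phase, ← Complex.exp_add, inner_add_right]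
  push_cast
  ring_nf

theorem phase_mul_phase_neg (α γ : Plane) : phase α γ * phase α (-γ) = 1 := by
  rw [← phase_add, add_neg_cancel, phase_zero]

theorem norm_phase (α γ : Plane) : ‖phase α γ‖ = 1 := by
  rw [phase, mul_comm, Complex.norm_exp_ofReal_mul_I]

theorem phase_apply_apply (R : Plane ≃ₗᵢ[ℝ] Plane) (α γ : Plane) :
    phase (R α) (R γ) = phase α γ := by
  rw [phase, phase, R.inner_map_map]

theorem continuous_phase (α : Plane) : Continuous (phase α) := by
  have h : Continuous fun γ : Plane => (inner ℝ α γ : ℝ) := continuous_const.inner continuous_id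
  exact Complex.continuous_exp.comp (continuous_const.mul (Complex.continuous_ofReal.comp h))

theorem green_add (v : Module.Basis (Fin 2) ℝ Plane) (α : Plane) (ω : ℂ) {γ : Plane}
    (hγ : γ ∈ lattice v) (x : Space) :
    green v α ω (x + (γ, 0)) = phase α γ * green v α ω x := by
  rw [green, green, mul_left_comm (phase α γ), ← tsum_mul_left (a := phase α γ)]
  congr 1
  refine tsum_congr fun q => ?_
  obtain ⟨n, hn⟩ := q.2 γ hγ
  have h : Complex.exp (Complex.I * ((inner ℝ (α + (q : Plane)) (x + (γ, 0)).1 : ℝ) : ℂ)) =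
      phase α γ * Complex.exp (Complex.I * ((inner ℝ (α + (q : Plane)) x.1 : ℝ) : ℂ)) := by
    rw [phase, ← Complex.exp_add, Prod.fst_add, inner_add_right, inner_add_left α _ γ, hn]
    -- The exponents differ by `i (q · γ) = 2πi n`.
    refine Complex.exp_eq_exp_iff_exists_int.2 ⟨n, ?_⟩
    push_cast
    ring
  rw [h, Prod.snd_add, add_zero]
  ring

theorem green_sub (v : Module.Basis (Fin 2) ℝ Plane) (α : Plane) (ω : ℂ) {γ : Plane}
    (hγ : γ ∈ lattice v) (x : Space) :
    green v α ω (x - (γ, 0)) = phase α (-γ) * green v α ω x := by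
  rw [← green_add v α ω (neg_mem hγ)]
  congr 1
  simp [sub_eq_add_neg]

/-- The field `φ` is quasi-periodic with quasi-momentum `α`. -/
def IsQuasiPeriodic (v : Module.Basis (Fin 2) ℝ Plane) (α : Plane) (φ : Space → CVec) : Prop :=
  ∀ γ ∈ lattice v, ∀ x, φ (x + (γ, 0)) = phase α γ • φ x

theorem IsQuasiPeriodic.fieldAction {v : Module.Basis (Fin 2) ℝ Plane} {α : Plane}
    {φ : Space → CVec} (hφ : IsQuasiPeriodic v α φ) {g : Plane ≃ᵃⁱ[ℝ] Plane}
    (hg : PreservesLattice v g.linearIsometryEquiv) :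
    IsQuasiPeriodic v (g.linearIsometryEquiv α) (fieldAction g φ) := by
  intro γ hγ x
  have h : g.linearIsometryEquiv (g.linearIsometryEquiv⁻¹ γ) = γ :=
    g.linearIsometryEquiv.apply_symm_apply γ
  have hγ' : g.linearIsometryEquiv⁻¹ γ ∈ lattice v := (hg _).1 (h.symm ▸ hγ)
  have hp := phase_apply_apply g.linearIsometryEquiv α (g.linearIsometryEquiv⁻¹ γ)
  rw [h] at hp
  rw [Metasurface.fieldAction, planeExtend_add, linear_inv, hφ _ hγ', rotate_smul, ← hp]
  rfl

/-! ### The metasurface as a disjoint union of translates -/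

/-- The translates of `D` by the lattice vectors are pairwise disjoint. -/
def HasDisjointTranslates (v : Module.Basis (Fin 2) ℝ Plane) (D : Set Space) : Prop :=
  ∀ x ∈ D, ∀ γ ∈ lattice v, x - (γ, 0) ∈ D → γ = 0

/-- Each lattice coordinate is an open map, so it sends the open set `D` into the interior of
`[-1/2, 1/2]`. Two points of `D` differing by a lattice vector then have integer coordinate
differences of absolute value less than `1`. -/
theorem hasDisjointTranslates_of_subset_cell {v : Module.Basis (Fin 2) ℝ Plane} {D : Set Space}
    (hD : IsOpen D) {t : Set ℝ} (hcell : D ⊆ cell v ×ˢ t) : HasDisjointTranslates v D := by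
  have hcoord (i : Fin 2) (x : Space) (hx : x ∈ D) : |v.repr x.1 i| < 1 / 2 := by
    let f : Space →ₗ[ℝ] ℝ := (v.coord i) ∘ₗ LinearMap.fst ℝ Plane ℝ
    have hf : Function.Surjective f := fun c => ⟨(c • v i, 0), by simp [f]⟩
    have hopen : IsOpenMap f := f.isOpenMap_of_finiteDimensional hf
    have hsub : f '' D ⊆ Set.Icc (-(1 / 2)) (1 / 2) := by
      rintro _ ⟨y, hy, rfl⟩
      obtain ⟨c, hc, hyc⟩ := (hcell hy).1
      have : f y = c i := by
        change v.coord i y.1 = c i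
        rw [hyc]
        fin_cases i <;> simp
      rw [this]
      exact hc i
    have := interior_maximal hsub (hopen D hD) ⟨x, hx, rfl⟩
    rw [interior_Icc] at this
    exact abs_lt.2 this
  intro x hx γ hγ hxγ
  have hint (i : Fin 2) : ∃ n : ℤ, (n : ℝ) = v.repr γ i := by
    have := (v.mem_span_iff_repr_mem ℤ γ).1 hγ i
    simpa using this
  refine v.ext_elem fun i => ?_
  obtain ⟨n, hn⟩ := hint i
  have h1 := hcoord i x hx
  have h2 := hcoord i _ hxγ
  have h3 : v.repr (x - ((γ, 0) : Space)).1 i = v.repr x.1 i - n := by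
    rw [hn, Prod.fst_sub, map_sub, Finsupp.sub_apply]
  rw [h3] at h2
  have h4 : |(n : ℝ)| < 1 := by
    rw [abs_lt] at *
    constructor <;> linarith
  have h5 : n = 0 := by
    rw [← Int.abs_lt_one_iff]
    exact_mod_cast h4
  rw [← hn, h5]
  simp

section Translates

variable {v : Module.Basis (Fin 2) ℝ Plane} {D : Set Space}

theorem sub_zero_zero (x : Space) : x - ((0, 0) : Space) = x := sub_zero x

theorem subset_metasurface (v : Module.Basis (Fin 2) ℝ Plane) (D : Set Space) :
    D ⊆ metasurface v D := fun x hx => ⟨0, zero_mem _, by rwa [sub_zero_zero]⟩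

theorem add_mem_metasurface_iff {γ : Plane} (hγ : γ ∈ lattice v) (x : Space) :
    x + (γ, 0) ∈ metasurface v D ↔ x ∈ metasurface v D := by
  constructor
  · rintro ⟨δ, hδ, h⟩
    refine ⟨δ - γ, sub_mem hδ hγ, ?_⟩
    convert h using 1
    refine Prod.ext ?_ (by simp)
    change x.1 - (δ - γ) = x.1 + γ - δ
    abel
  · rintro ⟨δ, hδ, h⟩
    refine ⟨δ + γ, add_mem hδ hγ, ?_⟩
    convert h using 1
    refine Prod.ext ?_ (by simp)
    change x.1 + γ - (δ + γ) = x.1 - δ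
    abel

theorem HasDisjointTranslates.eq (hD : HasDisjointTranslates v D) {x : Space} {γ δ : Plane}
    (hγ : γ ∈ lattice v) (hδ : δ ∈ lattice v) (h1 : x - (γ, 0) ∈ D) (h2 : x - (δ, 0) ∈ D) :
    γ = δ := by
  have := hD _ h1 (δ - γ) (sub_mem hδ hγ) (by convert h2 using 1; ext <;> simp)
  exact (sub_eq_zero.1 this).symm

/-- Disjointness leaves at most one nonzero term, so the series needs no convergence argument. -/
theorem HasDisjointTranslates.quasiPeriodicExtension_apply (hD : HasDisjointTranslates v D)
    (α : Plane) (f : Space → CVec) {x : Space} {γ : Plane} (hγ : γ ∈ lattice v)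
    (hx : x - (γ, 0) ∈ D) :
    quasiPeriodicExtension v D α f x = phase α γ • f (x - (γ, 0)) := by
  rw [quasiPeriodicExtension, tsum_eq_single ⟨γ, hγ⟩, Set.indicator_of_mem hx]
  · rfl
  · intro δ hδ
    rw [Set.indicator_of_notMem, smul_zero]
    exact fun h => hδ (Subtype.ext (hD.eq δ.2 hγ h hx))

theorem HasDisjointTranslates.quasiPeriodicExtension_of_mem (hD : HasDisjointTranslates v D)
    (α : Plane) (f : Space → CVec) {x : Space} (hx : x ∈ D) :
    quasiPeriodicExtension v D α f x = f x := by
  rw [hD.quasiPeriodicExtension_apply α f (zero_mem _) (by rwa [sub_zero_zero]), phase_zero, one_smul,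
    sub_zero_zero]

theorem quasiPeriodicExtension_of_notMem (α : Plane) (f : Space → CVec) {x : Space}
    (hx : x ∉ metasurface v D) : quasiPeriodicExtension v D α f x = 0 := by
  rw [quasiPeriodicExtension]
  convert tsum_zero with γ
  rw [Set.indicator_of_notMem, smul_zero]
  exact fun h => hx ⟨γ, γ.2, h⟩

theorem HasDisjointTranslates.isQuasiPeriodic (hD : HasDisjointTranslates v D)
    (α : Plane) (f : Space → CVec) :
    IsQuasiPeriodic v α (quasiPeriodicExtension v D α f) := by
  intro γ hγ x
  by_cases hx : x ∈ metasurface v D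
  · obtain ⟨δ, hδ, h⟩ := hx
    have he : x + ((γ, 0) : Space) - (γ + δ, 0) = x - (δ, 0) := by
      refine Prod.ext ?_ (by simp)
      change x.1 + γ - (γ + δ) = x.1 - δ
      abel
    rw [hD.quasiPeriodicExtension_apply α f hδ h,
      hD.quasiPeriodicExtension_apply α f (add_mem hγ hδ) (he ▸ h), he, phase_add, smul_smul]
  · rw [quasiPeriodicExtension_of_notMem α f hx, quasiPeriodicExtension_of_notMem α f
      ((add_mem_metasurface_iff hγ x).not.2 hx), smul_zero]

theorem HasDisjointTranslates.quasiPeriodicExtension_eq (hD : HasDisjointTranslates v D)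
    {α : Plane} {φ : Space → CVec} (hφ : IsQuasiPeriodic v α φ)
    (h0 : ∀ x ∉ metasurface v D, φ x = 0) : quasiPeriodicExtension v D α φ = φ := by
  funext x
  by_cases hx : x ∈ metasurface v D
  · obtain ⟨δ, hδ, h⟩ := hx
    rw [hD.quasiPeriodicExtension_apply α φ hδ h, ← hφ δ hδ, sub_add_cancel]
  · rw [quasiPeriodicExtension_of_notMem α φ hx, h0 x hx]

end Translates

theorem planeExtend_mem_metasurface {v : Module.Basis (Fin 2) ℝ Plane} {D : Set Space}
    {g : Plane ≃ᵃⁱ[ℝ] Plane} (hg : g ∈ symmetryGroup v D) {x : Space}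
    (hx : x ∈ metasurface v D) : planeExtend g x ∈ metasurface v D := by
  have h : planeExtend g '' metasurface v D = metasurface v D := hg
  rw [← h]
  exact ⟨x, hx, rfl⟩

theorem fieldAction_of_notMem {v : Module.Basis (Fin 2) ℝ Plane} {D : Set Space}
    {g : Plane ≃ᵃⁱ[ℝ] Plane} (hg : g ∈ symmetryGroup v D) {φ : Space → CVec}
    (h0 : ∀ x ∉ metasurface v D, φ x = 0) {x : Space} (hx : x ∉ metasurface v D) :
    fieldAction g φ x = 0 := by
  rw [fieldAction, h0, rotate_zero]
  intro h
  have := planeExtend_mem_metasurface hg h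
  rw [planeExtend_apply_inv] at this
  exact hx this

/-! ### Periodic integrands -/

instance isAddHaarMeasure_space : (volume : Measure Space).IsAddHaarMeasure :=
  inferInstanceAs ((volume : Measure Plane).prod (volume : Measure ℝ)).IsAddHaarMeasure

/-- The lattice `Λ × {0}`, as a group of translations of space. -/
def horizontalLattice (v : Module.Basis (Fin 2) ℝ Plane) : AddSubgroup Space :=
  (lattice v).map (AddMonoidHom.inl Plane ℝ)

instance countable_lattice (v : Module.Basis (Fin 2) ℝ Plane) : Countable (lattice v) :=
  inferInstanceAs (Countable (Submodule.span ℤ (Set.range v)))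

instance countable_horizontalLattice (v : Module.Basis (Fin 2) ℝ Plane) :
    Countable (horizontalLattice v) := by
  have h : (horizontalLattice v : Set Space) = AddMonoidHom.inl Plane ℝ '' lattice v :=
    AddSubgroup.coe_map _ _
  exact ((Set.countable_coe_iff.1 (countable_lattice v)).image _ |>.mono h.le).to_subtype

/-! ### Scatterers as fundamental domains of the lattice in the metasurface -/

section Domains

variable {v : Module.Basis (Fin 2) ℝ Plane} {D E : Set Space}

theorem measurableSet_metasurface (v : Module.Basis (Fin 2) ℝ Plane) (hD : IsOpen D) :
    MeasurableSet (metasurface v D) := by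
  have h : metasurface v D = ⋃ γ ∈ lattice v, {x | x - ((γ, 0) : Space) ∈ D} := by
    ext x; simp [metasurface]
  rw [h]
  refine (isOpen_biUnion fun γ _ => ?_).measurableSet
  exact hD.preimage (f := fun x : Space => x - ((γ, 0) : Space)) (by fun_prop)

/-- Restricting the measure to the metasurface lets the translates of `D` cover almost every point,
so that `D` becomes a fundamental domain although it does not fill a period cell. -/
theorem vaddInvariantMeasure_restrict : VAddInvariantMeasure
    (horizontalLattice v) Space (volume.restrict (metasurface v D)) := by
  refine ⟨fun c s hs => ?_⟩
  have hm : Measurable fun x : Space => c +ᵥ x := measurable_const_vadd c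
  have hmem (x : Space) : c +ᵥ x ∈ metasurface v D ↔ x ∈ metasurface v D := by
    obtain ⟨γ, hγ, hc⟩ := c.2
    rw [← add_mem_metasurface_iff hγ x]
    change (c : Space) + x ∈ _ ↔ _
    rw [← hc, add_comm]
    rfl
  rw [Measure.restrict_apply (hm hs), Measure.restrict_apply hs]
  have h : (fun x => c +ᵥ x) ⁻¹' s ∩ metasurface v D =
      (fun x => c +ᵥ x) ⁻¹' (s ∩ metasurface v D) := by
    ext x
    simp only [Set.mem_inter_iff, Set.mem_preimage, hmem]
  rw [h]
  exact measure_preimage_add volume (c : Space) _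

theorem HasDisjointTranslates.isAddFundamentalDomain (hE : IsOpen E)
    (hd : HasDisjointTranslates v E) (hED : metasurface v E = metasurface v D) :
    IsAddFundamentalDomain (horizontalLattice v) E (volume.restrict (metasurface v D)) := by
  refine ⟨hE.measurableSet.nullMeasurableSet, ?_, ?_⟩
  · rw [← hED]
    filter_upwards [ae_restrict_mem (measurableSet_metasurface v hE)] with x hx
    obtain ⟨γ, hγ, h⟩ := hx
    refine ⟨⟨(-γ, 0), -γ, neg_mem hγ, rfl⟩, ?_⟩
    convert h using 1
    refine Prod.ext ?_ ?_
    · exact neg_add_eq_sub γ x.1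
    · change 0 + x.2 = x.2 - 0
      simp
  · intro c d hcd
    refine Disjoint.aedisjoint ?_
    rw [Set.disjoint_left]
    rintro _ ⟨x, hx, rfl⟩ ⟨y, hy, hxy⟩
    refine hcd (Subtype.ext ?_)
    obtain ⟨γ, hγ, hc⟩ := c.2
    obtain ⟨δ, hδ, hd'⟩ := d.2
    have hxy' : (d : Space) + y = c + x := hxy
    rw [← hc, ← hd'] at hxy' ⊢
    change ((δ, 0) : Space) + y = (γ, 0) + x at hxy'
    change ((γ, 0) : Space) = (δ, 0)
    rw [hd.eq hγ hδ (x := (γ, 0) + x) (by rwa [add_sub_cancel_left])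
      (by rw [← hxy', add_sub_cancel_left]; exact hy)]

theorem vadd_eq_of_periodic {β : Type*} {f : Space → β}
    (hf : ∀ γ ∈ lattice v, ∀ x, f (x + (γ, 0)) = f x) (c : horizontalLattice v) (x : Space) :
    f (c +ᵥ x) = f x := by
  obtain ⟨γ, hγ, hc⟩ := c.2
  rw [← hf γ hγ x, add_comm]
  exact congrArg f (congrArg (· + x) hc.symm)

theorem restrict_restrict_metasurface (hE : IsOpen E) (hED : metasurface v E = metasurface v D) :
    (volume.restrict (metasurface v D)).restrict E = volume.restrict E := by
  rw [Measure.restrict_restrict hE.measurableSet, ← hED,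
    Set.inter_eq_left.2 (subset_metasurface v E)]

variable (hD : IsOpen D) (hE : IsOpen E) (hdD : HasDisjointTranslates v D)
  (hdE : HasDisjointTranslates v E) (hED : metasurface v E = metasurface v D)

include hD hE hdD hdE hED

theorem setIntegral_eq_of_periodic {F : Type*} [NormedAddCommGroup F] [NormedSpace ℝ F]
    {f : Space → F} (hf : ∀ γ ∈ lattice v, ∀ x, f (x + (γ, 0)) = f x) :
    ∫ x in E, f x = ∫ x in D, f x := by
  have := vaddInvariantMeasure_restrict (v := v) (D := D)
  have h := (hdE.isAddFundamentalDomain hE hED).setIntegral_eq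
    (hdD.isAddFundamentalDomain hD rfl) (vadd_eq_of_periodic hf)
  rwa [restrict_restrict_metasurface hE hED, restrict_restrict_metasurface hD rfl] at h

theorem setLIntegral_eq_of_periodic {f : Space → ENNReal}
    (hf : ∀ γ ∈ lattice v, ∀ x, f (x + (γ, 0)) = f x) :
    ∫⁻ x in E, f x = ∫⁻ x in D, f x := by
  have := vaddInvariantMeasure_restrict (v := v) (D := D)
  have h := (hdE.isAddFundamentalDomain hE hED).setLIntegral_eq
    (hdD.isAddFundamentalDomain hD rfl) f (vadd_eq_of_periodic hf)
  rwa [restrict_restrict_metasurface hE hED, restrict_restrict_metasurface hD rfl] at h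

theorem IsQuasiPeriodic.eLpNorm_eq {α : Plane} {φ : Space → CVec} (hφ : IsQuasiPeriodic v α φ) :
    eLpNorm φ 2 (volume.restrict E) = eLpNorm φ 2 (volume.restrict D) := by
  rw [eLpNorm_eq_lintegral_rpow_enorm_toReal (by simp) (by simp),
    eLpNorm_eq_lintegral_rpow_enorm_toReal (by simp) (by simp),
    setLIntegral_eq_of_periodic hD hE hdD hdE hED]
  intro γ hγ x
  rw [hφ γ hγ, enorm_smul, ← ofReal_norm (phase α γ), norm_phase]
  simp

/-- Measurability passes between fundamental domains for invariant functions only. The field is made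
periodic by the factor `exp(-i α · x')`, which is removed afterwards; `s = -1` and `s = 1` give
these two factors. -/
theorem IsQuasiPeriodic.aestronglyMeasurable {α : Plane} {φ : Space → CVec}
    (hφ : IsQuasiPeriodic v α φ) (hm : AEStronglyMeasurable φ (volume.restrict D)) :
    AEStronglyMeasurable φ (volume.restrict E) := by
  have := vaddInvariantMeasure_restrict (v := v) (D := D)
  have hc (s : ℝ) : Continuous fun x : Space => phase α (s • x.1) :=
    (continuous_phase α).comp (continuous_fst.const_smul s)
  have hper : ∀ γ ∈ lattice v, ∀ x : Space,
      phase α ((-1 : ℝ) • (x + (γ, 0)).1) • φ (x + (γ, 0)) = phase α ((-1 : ℝ) • x.1) • φ x := by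
    intro γ hγ x
    rw [hφ γ hγ, Prod.fst_add, smul_add, phase_add, smul_smul, mul_assoc, neg_one_smul ℝ γ,
      mul_comm (phase α (-γ)), phase_mul_phase_neg, mul_one]
  have h := (hdE.isAddFundamentalDomain hE hED).aestronglyMeasurable_on_iff
    (hdD.isAddFundamentalDomain hD rfl)
    (f := fun x : Space => phase α ((-1 : ℝ) • x.1) • φ x)
    (vadd_eq_of_periodic (f := fun x : Space => phase α ((-1 : ℝ) • x.1) • φ x) hper)
  rw [restrict_restrict_metasurface hE hED, restrict_restrict_metasurface hD rfl] at h
  have h2 := (hc 1).aestronglyMeasurable.smul (h.2 ((hc (-1)).aestronglyMeasurable.smul hm))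
  refine h2.congr (.of_forall fun x => ?_)
  change phase α ((1 : ℝ) • x.1) • phase α ((-1 : ℝ) • x.1) • φ x = φ x
  rw [smul_smul, one_smul, neg_one_smul, phase_mul_phase_neg, one_smul]

theorem IsQuasiPeriodic.memLp {α : Plane} {φ : Space → CVec}
    (hφ : IsQuasiPeriodic v α φ) (hm : MemLp φ 2 (volume.restrict D)) :
    MemLp φ 2 (volume.restrict E) :=
  ⟨hφ.aestronglyMeasurable hD hE hdD hdE hED hm.1, by
    rw [hφ.eLpNorm_eq hD hE hdD hdE hED]; exact hm.2⟩

end Domains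

/-- The lattice is countable, so the exceptional null sets of all translates can be combined. The
propagation of `P` is required only almost everywhere because potentials are determined only up to
null sets. -/
theorem ae_mem_metasurface_of_ae_mem {v : Module.Basis (Fin 2) ℝ Plane} {D : Set Space}
    {P : Space → Prop} (h : ∀ᵐ x, x ∈ D → P x)
    (hP : ∀ γ ∈ lattice v, ∀ᵐ x, P x → P (x + (γ, 0))) :
    ∀ᵐ x, x ∈ metasurface v D → P x := by
  have h1 : ∀ᵐ x, ∀ γ : lattice v, x - (((γ : Plane), 0) : Space) ∈ D → P x := by
    refine ae_all_iff.2 fun γ => ?_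
    have h2 : ∀ᵐ x, x ∈ D → P (x + ((γ : Plane), 0)) := by
      filter_upwards [h, hP γ γ.2] with x h3 h4 h5 using h4 (h3 h5)
    have h3 := (measurePreserving_sub_right (volume : Measure Space)
      (((γ : Plane), 0) : Space)).quasiMeasurePreserving.ae h2
    filter_upwards [h3] with x hx hxD
    simpa using hx hxD
  filter_upwards [h1] with x hx
  rintro ⟨γ, hγ, hxγ⟩
  exact hx ⟨γ, hγ⟩ hxγ

/-! ### The preimage of the scatterer under a symmetry -/

section Preimage

variable {v : Module.Basis (Fin 2) ℝ Plane} {D : Set Space} {g : Plane ≃ᵃⁱ[ℝ] Plane}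

theorem isOpen_preimage (hD : IsOpen D) : IsOpen (planeExtend g ⁻¹' D) :=
  hD.preimage (continuous_planeExtend g)

theorem planeExtend_mem_metasurface_iff (hg : g ∈ symmetryGroup v D) (x : Space) :
    planeExtend g x ∈ metasurface v D ↔ x ∈ metasurface v D := by
  refine ⟨fun h => ?_, planeExtend_mem_metasurface hg⟩
  have := planeExtend_mem_metasurface (inv_mem hg) h
  rwa [planeExtend_inv_apply] at this

theorem metasurface_preimage (hR : PreservesLattice v g.linearIsometryEquiv)
    (hg : g ∈ symmetryGroup v D) : metasurface v (planeExtend g ⁻¹' D) = metasurface v D := by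
  ext x
  rw [← planeExtend_mem_metasurface_iff hg x]
  constructor
  · rintro ⟨γ, hγ, h⟩
    refine ⟨g.linearIsometryEquiv γ, (hR γ).2 hγ, ?_⟩
    rw [← planeExtend_sub]
    exact h
  · rintro ⟨γ, hγ, h⟩
    refine ⟨g.linearIsometryEquiv.symm γ, (hR _).1 (by rwa [LinearIsometryEquiv.apply_symm_apply]),
      ?_⟩
    rw [Set.mem_preimage, planeExtend_sub, LinearIsometryEquiv.apply_symm_apply]
    exact h

theorem HasDisjointTranslates.preimage (hd : HasDisjointTranslates v D)
    (hR : PreservesLattice v g.linearIsometryEquiv) :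
    HasDisjointTranslates v (planeExtend g ⁻¹' D) := by
  intro x hx γ hγ h
  rw [Set.mem_preimage, planeExtend_sub] at h
  have := hd _ hx _ ((hR γ).2 hγ) h
  exact (LinearIsometryEquiv.map_eq_zero_iff _).1 this

end Preimage

/-! ### Covariance of the potentials -/

/-- A scatterer with disjoint translates, together with a symmetry of its metasurface that
preserves the lattice. -/
structure IsSymmetry (v : Module.Basis (Fin 2) ℝ Plane) (D : Set Space)
    (g : Plane ≃ᵃⁱ[ℝ] Plane) : Prop where
  isOpen : IsOpen D
  disjoint : HasDisjointTranslates v D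
  mem : g ∈ symmetryGroup v D
  preserves : PreservesLattice v g.linearIsometryEquiv

section

variable {v : Module.Basis (Fin 2) ℝ Plane} {D : Set Space} {g : Plane ≃ᵃⁱ[ℝ] Plane}

theorem IsSymmetry.inv (h : IsSymmetry v D g) : IsSymmetry v D g⁻¹ := by
  refine ⟨h.isOpen, h.disjoint, inv_mem h.mem, fun a => ?_⟩
  have h2 : g.linearIsometryEquiv (g.linearIsometryEquiv⁻¹ a) = a :=
    g.linearIsometryEquiv.apply_symm_apply a
  rw [linear_inv, ← h.preserves (g.linearIsometryEquiv⁻¹ a), h2]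

/-- A change of variables turns the left side into the integral over the preimage of `D` under `g`,
another fundamental domain for the same metasurface. -/
theorem IsSymmetry.setIntegral_comp_inv (h : IsSymmetry v D g) {F : Type*}
    [NormedAddCommGroup F] [NormedSpace ℝ F] {f : Space → F}
    (hf : ∀ γ ∈ lattice v, ∀ x, f (x + (γ, 0)) = f x) :
    ∫ x in D, f (planeExtend g⁻¹ x) = ∫ x in D, f x := by
  rw [← setIntegral_eq_of_periodic h.isOpen (isOpen_preimage h.isOpen) h.disjoint
    (h.disjoint.preimage h.preserves) (metasurface_preimage h.preserves h.mem) hf,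
    ← (measurePreserving_planeExtend g).setIntegral_preimage_emb
      (measurableEmbedding_planeExtend g)]
  simp only [planeExtend_inv_apply]

theorem IsSymmetry.vectorPotential_fieldAction (h : IsSymmetry v D g) {α : Plane} (ω : ℂ)
    {φ : Space → CVec} (hφ : IsQuasiPeriodic v α φ) (x : Space) :
    vectorPotential v D (g.linearIsometryEquiv α) ω (fieldAction g φ) (planeExtend g x)
      = rotate g.linearIsometryEquiv (vectorPotential v D α ω φ x) := by
  have hper : ∀ γ ∈ lattice v, ∀ y : Space,
      green v α ω (x - (y + (γ, 0))) • φ (y + (γ, 0)) = green v α ω (x - y) • φ y := by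
    intro γ hγ y
    rw [← sub_sub, green_sub v α ω hγ, hφ γ hγ, smul_smul, mul_right_comm,
      mul_comm (phase α (-γ)), phase_mul_phase_neg, one_mul]
  have hint : ∀ y : Space, green v (g.linearIsometryEquiv α) ω (planeExtend g x - y) •
      fieldAction g φ y = rotate g.linearIsometryEquiv (green v α ω (x - planeExtend g⁻¹ y) •
        φ (planeExtend g⁻¹ y)) := by
    intro y
    obtain ⟨z, rfl⟩ : ∃ z, y = planeExtend g z := ⟨_, (planeExtend_apply_inv g y).symm⟩
    rw [fieldAction_planeExtend, planeExtend_inv_apply, rotate_smul,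
      ← h.preserves.green_apply α ω (x - z)]
    congr 2
    refine Prod.ext ?_ rfl
    change g x.1 - g z.1 = g.linearIsometryEquiv (x.1 - z.1)
    rw [isometry_apply g x.1, isometry_apply g z.1, map_sub]
    abel
  rw [vectorPotential]
  simp only [hint]
  rw [show (∫ y in D, rotate g.linearIsometryEquiv (green v α ω (x - planeExtend g⁻¹ y) •
        φ (planeExtend g⁻¹ y))) = rotate g.linearIsometryEquiv (∫ y in D,
          green v α ω (x - planeExtend g⁻¹ y) • φ (planeExtend g⁻¹ y)) from
    -- A linear isometry commutes with the Bochner integral even without integrability, so no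
    -- estimate on the Green's function enters.
    (rotateIsometry g.linearIsometryEquiv).integral_comp_comm _,
    h.setIntegral_comp_inv (f := fun y => green v α ω (x - y) • φ y) hper]
  rfl

theorem vectorPotential_congr (hD : MeasurableSet D) (α : Plane) (ω : ℂ) {φ ψ : Space → CVec}
    (h : ∀ᵐ x, x ∈ D → φ x = ψ x) : vectorPotential v D α ω φ = vectorPotential v D α ω ψ := by
  funext x
  refine setIntegral_congr_ae hD ?_
  filter_upwards [h] with y hy hyD
  rw [hy hyD]

theorem vectorPotential_smul (α : Plane) (ω c : ℂ) (φ : Space → CVec) (x : Space) :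
    vectorPotential v D α ω (fun y => c • φ y) x = c • vectorPotential v D α ω φ x := by
  rw [vectorPotential, vectorPotential, ← integral_smul]
  simp only [smul_comm c]

theorem electricPotential_congr (hD : MeasurableSet D) (α : Plane) (ω : ℂ) {φ ψ : Space → CVec}
    (h : ∀ᵐ x, x ∈ D → φ x = ψ x) (θ : Space → CVec) :
    electricPotential v D α ω φ θ = electricPotential v D α ω ψ θ := by
  rw [electricPotential, electricPotential, vectorPotential_congr hD α ω h]

theorem electricPotential_smul (α : Plane) (ω c : ℂ) (φ θ : Space → CVec) :
    electricPotential v D α ω (fun y => c • φ y) θ = c * electricPotential v D α ω φ θ := by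
  rw [electricPotential, electricPotential, ← integral_const_mul]
  simp only [vectorPotential_smul, PiLp.smul_apply, smul_eq_mul, mul_assoc, Finset.mul_sum]

theorem electricPotential_eq_integral_dot (α : Plane) (ω : ℂ) (φ θ : Space → CVec) :
    electricPotential v D α ω φ θ = ∫ x, dot (vectorPotential v D α ω φ x)
      (ω ^ 2 • θ x + gradient (divergence θ) x) := rfl

theorem IsSymmetry.electricPotential_fieldAction (h : IsSymmetry v D g) {α : Plane} (ω : ℂ)
    {φ : Space → CVec} (hφ : IsQuasiPeriodic v α φ) {θ : Space → CVec} (hθ : IsTest θ) :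
    electricPotential v D (g.linearIsometryEquiv α) ω (fieldAction g φ) (fieldAction g θ)
      = electricPotential v D α ω φ θ := by
  rw [electricPotential_eq_integral_dot, electricPotential_eq_integral_dot,
    ← integral_comp_planeExtend g]
  have hdiv : divergence (fieldAction g θ) = fun x => divergence θ (planeExtend g⁻¹ x) :=
    funext fun x => divergence_fieldAction g (hθ.1.differentiable (by simp)) x
  simp only [hdiv, gradient_comp_planeExtend_inv, fieldAction_planeExtend, planeExtend_inv_apply,
    h.vectorPotential_fieldAction ω hφ, ← rotate_smul, ← rotate_add, dot_rotate]

theorem IsSymmetry.isElectricPotential_fieldAction_iff (h : IsSymmetry v D g) {α : Plane} (ω : ℂ)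
    {φ : Space → CVec} (hφ : IsQuasiPeriodic v α φ) (u : Space → CVec) :
    IsElectricPotential v D (g.linearIsometryEquiv α) ω (fieldAction g φ) (fieldAction g u)
      ↔ IsElectricPotential v D α ω φ u := by
  refine and_congr (locallyIntegrable_fieldAction_iff g u) ⟨fun hu θ hθ => ?_, fun hu θ hθ => ?_⟩
  · have := hu _ (hθ.fieldAction g)
    rwa [integral_dot_fieldAction, h.electricPotential_fieldAction ω hφ hθ] at this
  · have hθ' := hθ.fieldAction g⁻¹
    rw [← fieldAction_fieldAction_inv g θ, integral_dot_fieldAction,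
      h.electricPotential_fieldAction ω hφ hθ', hu _ hθ']

theorem isElectricPotential_congr (hD : MeasurableSet D) (α : Plane) (ω : ℂ) {φ ψ : Space → CVec}
    (h : ∀ᵐ x, x ∈ D → φ x = ψ x) (u : Space → CVec) :
    IsElectricPotential v D α ω φ u ↔ IsElectricPotential v D α ω ψ u := by
  simp only [IsElectricPotential, electricPotential_congr hD α ω h]

theorem IsElectricPotential.const_smul {α : Plane} {ω : ℂ} {φ u : Space → CVec}
    (hu : IsElectricPotential v D α ω φ u) (c : ℂ) :
    IsElectricPotential v D α ω (fun x => c • φ x) (fun x => c • u x) := by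
  refine ⟨hu.1.smul c, fun θ hθ => ?_⟩
  rw [electricPotential_smul, ← hu.2 θ hθ, ← integral_const_mul]
  simp only [dot, PiLp.smul_apply, smul_eq_mul, mul_assoc, Finset.mul_sum]

/-- Testing against `η e_i` reduces this to the fundamental lemma of the calculus of variations in
each component. -/
theorem IsElectricPotential.ae_unique {α : Plane} {ω : ℂ} {φ u w : Space → CVec}
    (hu : IsElectricPotential v D α ω φ u) (hw : IsElectricPotential v D α ω φ w) :
    ∀ᵐ x, u x = w x := by
  have hint (i : Fin 3) {u : Space → CVec} (hu : LocallyIntegrable u) :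
      LocallyIntegrable fun x => u x i :=
    hu.mono (show AEStronglyMeasurable (fun x => u x i) volume from
      (EuclideanSpace.proj (𝕜 := ℂ) i).continuous.comp_aestronglyMeasurable
        hu.aestronglyMeasurable) (.of_forall fun x => PiLp.norm_apply_le (u x) i)
  have hi (i : Fin 3) : ∀ᵐ x, u x i = w x i := by
    refine ae_eq_of_integral_contDiff_smul_eq (hint i hu.1) (hint i hw.1) fun η hη hs => ?_
    let θ : Space → CVec := fun x => η x • EuclideanSpace.single i 1
    have hθ : IsTest θ := ⟨hη.smul contDiff_const, hs.smul_right⟩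
    have hdot (u : Space → CVec) (x : Space) : η x • u x i = dot (u x) (θ x) := by
      simp [dot, θ, mul_comm]
    simp only [hdot]
    rw [hu.2 θ hθ, hw.2 θ hθ]
  filter_upwards [hi 0, hi 1, hi 2] with x h0 h1 h2
  ext i
  fin_cases i <;> assumption

/-! ### Translations -/

theorem isSymmetry_constVAdd (hD : IsOpen D) (hd : HasDisjointTranslates v D)
    {γ : Plane} (hγ : γ ∈ lattice v) :
    IsSymmetry v D (AffineIsometryEquiv.constVAdd ℝ Plane γ) := by
  refine ⟨hD, hd, ?_, fun a => Iff.rfl⟩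
  change planeExtend _ '' metasurface v D = metasurface v D
  have h (x : Space) : planeExtend (AffineIsometryEquiv.constVAdd ℝ Plane γ) x = x + (γ, 0) :=
    Prod.ext (add_comm γ x.1) (add_zero x.2).symm
  ext x
  constructor
  · rintro ⟨y, hy, rfl⟩
    rwa [h, add_mem_metasurface_iff hγ]
  · intro hx
    refine ⟨x - (γ, 0), ?_, by rw [h, sub_add_cancel]⟩
    rwa [← add_mem_metasurface_iff hγ, sub_add_cancel]

theorem fieldAction_constVAdd (γ : Plane) (φ : Space → CVec) (x : Space) :
    fieldAction (AffineIsometryEquiv.constVAdd ℝ Plane γ) φ x = φ (x - (γ, 0)) := by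
  have h : planeExtend (AffineIsometryEquiv.constVAdd ℝ Plane γ)⁻¹ x = x - (γ, 0) :=
    Prod.ext (neg_add_eq_sub γ x.1) (sub_zero x.2).symm
  have h1 : (AffineIsometryEquiv.constVAdd ℝ Plane γ).linearIsometryEquiv = 1 := rfl
  rw [fieldAction, h, h1, rotate_one]

/-- Translation by `-γ` is a symmetry with trivial linear part that multiplies `φ` by the phase. By
covariance and linearity, the translate of `u` and the phase times `u` are potentials of one field,
hence equal almost everywhere. -/
theorem IsElectricPotential.ae_add {α : Plane} {ω : ℂ} {φ u : Space → CVec} (hD : IsOpen D)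
    (hd : HasDisjointTranslates v D) (hφ : IsQuasiPeriodic v α φ)
    (hu : IsElectricPotential v D α ω φ u) {γ : Plane} (hγ : γ ∈ lattice v) :
    ∀ᵐ x, u (x + (γ, 0)) = phase α γ • u x := by
  have h1 := ((isSymmetry_constVAdd hD hd (neg_mem hγ)).isElectricPotential_fieldAction_iff
    ω hφ u).2 hu
  have h2 : fieldAction (AffineIsometryEquiv.constVAdd ℝ Plane (-γ)) φ =
      fun x => phase α γ • φ x := by
    funext x
    rw [fieldAction_constVAdd, ← hφ γ hγ]
    congr 1
    ext <;> simp
  rw [h2] at h1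
  filter_upwards [h1.ae_unique (hu.const_smul (phase α γ))] with x hx
  rw [← hx, fieldAction_constVAdd]
  congr 1
  ext <;> simp

theorem IsSymmetry.operatorGraph_fieldAction (h : IsSymmetry v D g) {τ : ℝ} {α : Plane} {ω : ℂ}
    {φ ψ : Space → CVec} (hφ : IsQuasiPeriodic v α φ) (hψ : IsQuasiPeriodic v α ψ)
    (hgr : OperatorGraph v D τ α ω φ ψ) :
    OperatorGraph v D τ (g.linearIsometryEquiv α) ω (fieldAction g φ) (fieldAction g ψ) := by
  obtain ⟨u, hu, hae⟩ := hgr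
  refine ⟨fieldAction g u, (h.isElectricPotential_fieldAction_iff ω hφ u).2 hu, ?_⟩
  rw [ae_restrict_iff' h.isOpen.measurableSet] at hae ⊢
  -- For `x ∈ D` the point `g⁻¹ x` need only lie in the metasurface, so the equation is first
  -- extended from `D` to all translates.
  have h1 := ae_mem_metasurface_of_ae_mem (v := v) hae fun γ hγ => by
    filter_upwards [hu.ae_add h.isOpen h.disjoint hφ hγ] with x hx hx'
    rw [hx, hφ γ hγ, hψ γ hγ, hx', smul_sub, smul_comm]
  have h2 := (measurePreserving_planeExtend g⁻¹).quasiMeasurePreserving.ae h1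
  filter_upwards [h2] with x hx hxD
  have h3 := hx (planeExtend_mem_metasurface (inv_mem h.mem) (subset_metasurface v D hxD))
  rw [fieldAction, h3, sub_eq_add_neg, ← neg_one_smul ℂ (u _), rotate_add, rotate_smul,
    rotate_smul, neg_one_smul, ← sub_eq_add_neg]
  rfl

theorem operatorGraph_congr (hD : MeasurableSet D) {τ : ℝ} {α : Plane} {ω : ℂ}
    {φ φ' ψ ψ' : Space → CVec} (hφ : ∀ᵐ x, x ∈ D → φ x = φ' x) (hψ : ∀ᵐ x, x ∈ D → ψ x = ψ' x)
    (h : OperatorGraph v D τ α ω φ ψ) : OperatorGraph v D τ α ω φ' ψ' := by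
  obtain ⟨u, hu, hae⟩ := h
  refine ⟨u, (isElectricPotential_congr hD α ω hφ u).1 hu, ?_⟩
  rw [ae_restrict_iff' hD] at hae ⊢
  filter_upwards [hae, hφ, hψ] with x h1 h2 h3 hx
  rw [← h2 hx, ← h3 hx, h1 hx]

end

/-! ### Divergence-free fields -/

section DivFree

variable {v : Module.Basis (Fin 2) ℝ Plane} {D : Set Space}

theorem gradient_of_notMem_tsupport {η : Space → ℂ} {x : Space} (hx : x ∉ tsupport η) :
    gradient η x = 0 := by
  ext i
  simp [gradient, partialDeriv, fderiv_of_notMem_tsupport ℝ hx]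

theorem dot_zero (a : CVec) : dot a 0 = 0 := by simp [dot]

theorem dot_smul (c : ℂ) (a b : CVec) : dot (c • a) b = c * dot a b := by
  simp [dot, Finset.mul_sum, mul_assoc]

theorem setIntegral_eq_integral_dot_gradient (φ : Space → CVec) {η : Space → ℂ}
    (hs : tsupport η ⊆ D) :
    ∫ x in D, ∑ i, φ x i * partialDeriv i η x = ∫ x, dot (φ x) (gradient η x) := by
  refine setIntegral_eq_integral_of_forall_compl_eq_zero
    (f := fun x => dot (φ x) (gradient η x)) fun x hx => ?_
  rw [gradient_of_notMem_tsupport fun h => hx (hs h), dot_zero]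

theorem integrable_dot_gradient {φ : Space → CVec}
    (hφ : MemLp φ 2 (volume.restrict D)) {η : Space → ℂ} (hη : IsTest η) (hs : tsupport η ⊆ D) :
    Integrable fun x => dot (φ x) (gradient η x) := by
  have h : IntegrableOn (fun x => dot (φ x) (gradient η x)) D := by
    refine (integrable_mul_partialDeriv D (hφ.toLp φ) η hη).congr ?_
    filter_upwards [hφ.coeFn_toLp] with x hx
    rw [hx]
    rfl
  refine (integrableOn_iff_integrable_of_support_subset fun x hx => ?_).1 h
  by_contra hxD
  exact hx (by
    change dot (φ x) (gradient η x) = 0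
    rw [gradient_of_notMem_tsupport fun h => hxD (hs h), dot_zero])

theorem isDivFree_congr (hD : MeasurableSet D) {φ ψ : Space → CVec}
    (h : ∀ᵐ x, x ∈ D → φ x = ψ x) (hφ : IsDivFree D φ) : IsDivFree D ψ := by
  intro η hη hs
  rw [← hφ η hη hs]
  refine setIntegral_congr_ae hD ?_
  filter_upwards [h] with x hx hxD
  rw [hx hxD]

theorem gradient_comp_add (η : Space → ℂ) (a x : Space) :
    gradient (fun y => η (y + a)) x = gradient η (x + a) := by
  ext i
  simp only [gradient, partialDeriv, fderiv_comp_add_right]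

theorem IsTest.comp_add {η : Space → ℂ} (hη : IsTest η) (a : Space) :
    IsTest fun x => η (x + a) :=
  ⟨hη.1.comp (contDiff_id.add contDiff_const), hη.2.comp_homeomorph (Homeomorph.addRight a)⟩

theorem tsupport_comp_add (η : Space → ℂ) (a : Space) :
    tsupport (fun x => η (x + a)) = {x | x + a ∈ tsupport η} :=
  tsupport_comp_eq_preimage η (Homeomorph.addRight a)

/-- Translating by `γ` moves the support of `η` into `D` and changes the integrand only by a
constant phase. -/
theorem IsQuasiPeriodic.integrable_and_integral_eq_zero {α : Plane}
    {φ : Space → CVec} (hφ : IsQuasiPeriodic v α φ) (hm : MemLp φ 2 (volume.restrict D))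
    (hdiv : IsDivFree D φ) {γ : Plane} (hγ : γ ∈ lattice v) {η : Space → ℂ} (hη : IsTest η)
    (hs : tsupport η ⊆ {x | x - ((γ, 0) : Space) ∈ D}) :
    Integrable (fun x => dot (φ x) (gradient η x)) ∧ ∫ x, dot (φ x) (gradient η x) = 0 := by
  have hη' := hη.comp_add (γ, 0)
  have hs' : tsupport (fun x => η (x + (γ, 0))) ⊆ D := by
    rw [tsupport_comp_add]
    intro x hx
    have := hs hx
    change x + (γ, 0) - (γ, 0) ∈ D at this
    rwa [add_sub_cancel_right] at this
  have hadd : (fun x : Space => dot (φ (x + (γ, 0))) (gradient η (x + (γ, 0)))) =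
      fun x => phase α γ * dot (φ x) (gradient (fun y => η (y + (γ, 0))) x) := by
    funext x
    rw [hφ γ hγ, dot_smul, gradient_comp_add]
  constructor
  · have h := ((integrable_dot_gradient hm hη' hs').const_mul (phase α γ))
    rw [← hadd] at h
    simpa using h.comp_sub_right ((γ, 0) : Space)
  · rw [← integral_add_right_eq_self _ ((γ, 0) : Space), hadd, integral_const_mul,
      ← setIntegral_eq_integral_dot_gradient φ hs', hdiv _ hη' hs', mul_zero]

/-- A test function supported in the union of two disjoint open sets splits into two test
functions. -/
theorem IsTest.indicator {η : Space → ℂ} (hη : IsTest η) {U V : Set Space} (hU : IsOpen U)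
    (hV : IsOpen V) (hUV : Disjoint U V) (hs : tsupport η ⊆ U ∪ V) :
    IsTest (U.indicator η) ∧ tsupport (U.indicator η) ⊆ U := by
  have hsub : tsupport (U.indicator η) ⊆ tsupport η ∩ Vᶜ := by
    refine closure_minimal (fun x hx => ?_) ((isClosed_tsupport η).inter hV.isClosed_compl)
    have hxU : x ∈ U := Set.mem_of_indicator_ne_zero hx
    refine ⟨subset_tsupport η ?_, fun hxV => Set.disjoint_left.1 hUV hxU hxV⟩
    rw [Function.mem_support, Set.indicator_of_mem hxU] at hx
    exact hx
  refine ⟨⟨contDiff_iff_contDiffAt.2 fun x => ?_,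
    hη.2.of_isClosed_subset (isClosed_tsupport _) (hsub.trans Set.inter_subset_left)⟩,
    fun x hx => (hs (hsub hx).1).resolve_right (hsub hx).2⟩
  by_cases hxU : x ∈ U
  · refine hη.1.contDiffAt.congr_of_eventuallyEq ?_
    filter_upwards [hU.mem_nhds hxU] with y hy using Set.indicator_of_mem hy η
  · have hx : x ∉ tsupport (U.indicator η) := fun hx =>
      hxU ((hs (hsub hx).1).resolve_right (hsub hx).2)
    exact contDiffAt_const.congr_of_eventuallyEq (notMem_tsupport_iff_eventuallyEq.1 hx)

theorem gradient_finsetSum {ι : Type*} (s : Finset ι) (f : ι → Space → ℂ)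
    (hf : ∀ i ∈ s, Differentiable ℝ (f i)) (x : Space) :
    gradient (fun y => ∑ i ∈ s, f i y) x = ∑ i ∈ s, gradient (f i) x := by
  ext k
  simp only [gradient, partialDeriv]
  rw [fderiv_fun_sum fun i hi => hf i hi x]
  simp

theorem dot_sum {ι : Type*} (s : Finset ι) (a : CVec) (b : ι → CVec) :
    dot a (∑ i ∈ s, b i) = ∑ i ∈ s, dot a (b i) := by
  simp only [dot, WithLp.ofLp_sum, Finset.sum_apply, Finset.mul_sum]
  exact Finset.sum_comm

/-- A compact support meets only finitely many of the disjoint open translates of `D`. The test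
function is thus a finite sum of test functions, each supported in a single translate. -/
theorem IsQuasiPeriodic.isDivFree_metasurface (hD : IsOpen D) (hd : HasDisjointTranslates v D)
    {α : Plane} {φ : Space → CVec} (hφ : IsQuasiPeriodic v α φ)
    (hm : MemLp φ 2 (volume.restrict D)) (hdiv : IsDivFree D φ) :
    IsDivFree (metasurface v D) φ := by
  intro η hη hs
  rw [setIntegral_eq_integral_dot_gradient φ hs]
  let U : lattice v → Set Space := fun γ => {x | x - (((γ : Plane), 0) : Space) ∈ D}
  have hU (γ : lattice v) : IsOpen (U γ) :=
    hD.preimage (f := fun x : Space => x - (((γ : Plane), 0) : Space)) (by fun_prop)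
  have hsU : tsupport η ⊆ ⋃ γ, U γ := fun x hx => by
    obtain ⟨γ, hγ, h⟩ := hs hx
    exact Set.mem_iUnion.2 ⟨⟨γ, hγ⟩, h⟩
  have hUU {γ δ : lattice v} {x : Space} (h1 : x ∈ U γ) (h2 : x ∈ U δ) : γ = δ :=
    Subtype.ext (hd.eq γ.2 δ.2 h1 h2)
  obtain ⟨F, hF⟩ := hη.2.elim_finite_subcover U hU hsU
  have hpiece (γ : lattice v) : IsTest ((U γ).indicator η) ∧
      tsupport ((U γ).indicator η) ⊆ U γ := by
    -- The second open set is the union of all the other translates.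
    refine hη.indicator (hU γ) (V := ⋃ δ ∈ {δ | δ ≠ γ}, U δ)
      (isOpen_biUnion fun δ _ => hU δ) ?_ ?_
    · rw [Set.disjoint_left]
      intro x hx hx'
      obtain ⟨δ, hδ, hxδ⟩ := Set.mem_iUnion₂.1 hx'
      exact hδ (hUU hxδ hx)
    · intro x hx
      obtain ⟨δ, hxδ⟩ := Set.mem_iUnion.1 (hsU hx)
      by_cases h : δ = γ
      · exact Or.inl (h ▸ hxδ)
      · exact Or.inr (Set.mem_iUnion₂.2 ⟨δ, h, hxδ⟩)
  have hsum : η = fun x => ∑ γ ∈ F, (U γ).indicator η x := by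
    funext x
    by_cases hx : x ∈ tsupport η
    · obtain ⟨δ, hδ, hxδ⟩ := Set.mem_iUnion₂.1 (hF hx)
      rw [Finset.sum_eq_single_of_mem δ hδ, Set.indicator_of_mem hxδ]
      intro γ _ hγ
      exact Set.indicator_of_notMem (fun h => hγ (hUU h hxδ)) _
    · rw [image_eq_zero_of_notMem_tsupport hx]
      refine (Finset.sum_eq_zero fun γ _ => ?_).symm
      simp [image_eq_zero_of_notMem_tsupport hx]
  have hgrad (x : Space) : dot (φ x) (gradient η x) =
      ∑ γ ∈ F, dot (φ x) (gradient ((U γ).indicator η) x) := by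
    conv_lhs => rw [hsum]
    rw [gradient_finsetSum F (fun γ => (U γ).indicator η)
      fun γ _ => (hpiece γ).1.1.differentiable (by simp), dot_sum]
  have hpair (γ : lattice v) := hφ.integrable_and_integral_eq_zero hm hdiv γ.2
    (hpiece γ).1 (hpiece γ).2
  simp only [hgrad]
  rw [integral_finsetSum F fun γ _ => (hpair γ).1]
  exact Finset.sum_eq_zero fun γ _ => (hpair γ).2

/-- Pulling a test function back by `g` gives one supported in the metasurface, though perhaps not
in `D`; this is why the divergence condition was extended to all translates. -/
theorem IsSymmetry.isDivFree_fieldAction {g : Plane ≃ᵃⁱ[ℝ] Plane} (h : IsSymmetry v D g)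
    {α : Plane} {φ : Space → CVec} (hφ : IsQuasiPeriodic v α φ)
    (hm : MemLp φ 2 (volume.restrict D)) (hdiv : IsDivFree D φ) :
    IsDivFree D (fieldAction g φ) := by
  intro η hη hs
  have hη' : IsTest fun x => η (planeExtend g x) :=
    ⟨hη.1.comp (contDiff_planeExtend g), hη.2.comp_homeomorph (planeHomeo g)⟩
  have hs' : tsupport (fun x => η (planeExtend g x)) ⊆ metasurface v D := by
    have ht : tsupport (fun x => η (planeExtend g x)) = planeExtend g ⁻¹' tsupport η :=
      tsupport_comp_eq_preimage η (planeHomeo g)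
    rw [ht]
    exact fun x hx => (planeExtend_mem_metasurface_iff h.mem x).1 (subset_metasurface v D (hs hx))
  have hgrad (x : Space) : gradient η (planeExtend g x) =
      rotate g.linearIsometryEquiv (gradient (fun y => η (planeExtend g y)) x) := by
    have := gradient_comp_planeExtend_inv g (fun y => η (planeExtend g y)) (planeExtend g x)
    simpa only [planeExtend_apply_inv, planeExtend_inv_apply] using this
  rw [setIntegral_eq_integral_dot_gradient _ hs, ← integral_comp_planeExtend g]
  simp only [fieldAction_planeExtend, hgrad, dot_rotate]
  rw [← setIntegral_eq_integral_dot_gradient φ hs']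
  exact hφ.isDivFree_metasurface h.isOpen h.disjoint hm hdiv _ hη' hs'

end DivFree

/-! ### Square integrable quasi-periodic fields -/

/-- A field is quasi-periodic, vanishes off the metasurface and is square integrable in `D`. -/
structure IsQuasiField (v : Module.Basis (Fin 2) ℝ Plane) (D : Set Space) (α : Plane)
    (φ : Space → CVec) : Prop where
  quasiPeriodic : IsQuasiPeriodic v α φ
  eq_zero : ∀ x ∉ metasurface v D, φ x = 0
  memLp : MemLp φ 2 (volume.restrict D)

section QuasiField

variable {v : Module.Basis (Fin 2) ℝ Plane} {D : Set Space} {g : Plane ≃ᵃⁱ[ℝ] Plane} {α : Plane}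

theorem isQuasiField_quasiPeriodicExtension (hD : IsOpen D) (hd : HasDisjointTranslates v D)
    (α : Plane) {f : Space → CVec} (hf : MemLp f 2 (volume.restrict D)) :
    IsQuasiField v D α (quasiPeriodicExtension v D α f) := by
  refine ⟨hd.isQuasiPeriodic α f, fun x hx => quasiPeriodicExtension_of_notMem α f hx, ?_⟩
  refine hf.ae_eq ?_
  filter_upwards [ae_restrict_mem hD.measurableSet] with x hx
  rw [hd.quasiPeriodicExtension_of_mem α f hx]

/-- This supplies a representative for which quasi-periodicity and vanishing off the metasurface
hold at every point, as the covariance lemmas require. -/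
theorem memL2Quasi_iff (hD : IsOpen D) (hd : HasDisjointTranslates v D) (φ : Space → CVec) :
    MemL2Quasi v D α φ ↔ ∃ ψ, IsQuasiField v D α ψ ∧ ∀ᵐ x, φ x = ψ x := by
  constructor
  · rintro ⟨f, hf, h⟩
    exact ⟨_, isQuasiField_quasiPeriodicExtension hD hd α hf, h⟩
  · rintro ⟨ψ, hψ, h⟩
    refine ⟨ψ, hψ.memLp, ?_⟩
    rwa [hd.quasiPeriodicExtension_eq hψ.quasiPeriodic hψ.eq_zero]

theorem ae_eq_fieldAction (g : Plane ≃ᵃⁱ[ℝ] Plane) {φ ψ : Space → CVec} (h : ∀ᵐ x, φ x = ψ x) :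
    ∀ᵐ x, fieldAction g φ x = fieldAction g ψ x := by
  filter_upwards [(measurePreserving_planeExtend g⁻¹).quasiMeasurePreserving.ae h] with x hx
  rw [fieldAction, fieldAction, hx]

theorem measurePreserving_restrict (g : Plane ≃ᵃⁱ[ℝ] Plane) (D : Set Space) :
    MeasurePreserving (planeExtend g⁻¹) (volume.restrict D)
      (volume.restrict (planeExtend g ⁻¹' D)) := by
  have h := (measurePreserving_planeExtend g⁻¹).restrict_preimage_emb
    (measurableEmbedding_planeExtend g⁻¹) (planeExtend g ⁻¹' D)
  rw [← Set.preimage_comp] at h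
  have h2 : planeExtend g ∘ planeExtend g⁻¹ = id := funext (planeExtend_apply_inv g)
  rwa [h2, Set.preimage_id] at h

theorem IsSymmetry.isQuasiField_fieldAction (h : IsSymmetry v D g) {φ : Space → CVec}
    (hφ : IsQuasiField v D α φ) :
    IsQuasiField v D (g.linearIsometryEquiv α) (fieldAction g φ) := by
  refine ⟨hφ.quasiPeriodic.fieldAction h.preserves,
    fun x hx => fieldAction_of_notMem h.mem hφ.eq_zero hx, ?_⟩
  have h1 := (hφ.quasiPeriodic.memLp h.isOpen (isOpen_preimage h.isOpen) h.disjoint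
    (h.disjoint.preimage h.preserves) (metasurface_preimage h.preserves h.mem)
    hφ.memLp).comp_measurePreserving (measurePreserving_restrict g D)
  exact h1.of_le ((continuous_rotate _).comp_aestronglyMeasurable h1.1)
    (.of_forall fun x => (norm_rotate _ _).le)

theorem IsSymmetry.eLpNorm_fieldAction (h : IsSymmetry v D g) {φ : Space → CVec}
    (hφ : IsQuasiField v D α φ) :
    eLpNorm (fieldAction g φ) 2 (volume.restrict D) = eLpNorm φ 2 (volume.restrict D) := by
  have hd := h.disjoint.preimage h.preserves
  have hm := metasurface_preimage h.preserves h.mem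
  have ho := isOpen_preimage (g := g) h.isOpen
  rw [← hφ.quasiPeriodic.eLpNorm_eq h.isOpen ho h.disjoint hd hm,
    ← eLpNorm_comp_measurePreserving
      (hφ.quasiPeriodic.memLp h.isOpen ho h.disjoint hd hm hφ.memLp).1
      (measurePreserving_restrict g D)]
  exact eLpNorm_congr_norm_ae (.of_forall fun x => norm_rotate _ _)

theorem HasDisjointTranslates.quasiPeriodicExtension_congr (hd : HasDisjointTranslates v D)
    (α : Plane) {f f' : Space → CVec} (h : ∀ᵐ x, x ∈ D → f x = f' x) :
    ∀ᵐ x, quasiPeriodicExtension v D α f x = quasiPeriodicExtension v D α f' x := by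
  have h1 : ∀ᵐ x, x ∈ D →
      quasiPeriodicExtension v D α f x = quasiPeriodicExtension v D α f' x := by
    filter_upwards [h] with x hx hxD
    rw [hd.quasiPeriodicExtension_of_mem α f hxD, hd.quasiPeriodicExtension_of_mem α f' hxD, hx hxD]
  filter_upwards [ae_mem_metasurface_of_ae_mem (v := v) h1 fun γ hγ => .of_forall fun x hx => by
    rw [hd.isQuasiPeriodic α f γ hγ, hd.isQuasiPeriodic α f' γ hγ, hx]] with x hx
  by_cases hxm : x ∈ metasurface v D
  · exact hx hxm
  · rw [quasiPeriodicExtension_of_notMem α f hxm, quasiPeriodicExtension_of_notMem α f' hxm]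

theorem HasDisjointTranslates.quasiPeriodicExtension_add (hd : HasDisjointTranslates v D)
    (α : Plane) (f f' : Space → CVec) (x : Space) :
    quasiPeriodicExtension v D α (fun y => f y + f' y) x =
      quasiPeriodicExtension v D α f x + quasiPeriodicExtension v D α f' x := by
  by_cases hx : x ∈ metasurface v D
  · obtain ⟨γ, hγ, h⟩ := hx
    simp only [hd.quasiPeriodicExtension_apply α _ hγ h, smul_add]
  · simp only [quasiPeriodicExtension_of_notMem α _ hx, add_zero]

theorem HasDisjointTranslates.quasiPeriodicExtension_smul (hd : HasDisjointTranslates v D)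
    (α : Plane) (c : ℂ) (f : Space → CVec) (x : Space) :
    quasiPeriodicExtension v D α (fun y => c • f y) x =
      c • quasiPeriodicExtension v D α f x := by
  by_cases hx : x ∈ metasurface v D
  · obtain ⟨γ, hγ, h⟩ := hx
    simp only [hd.quasiPeriodicExtension_apply α _ hγ h, smul_comm c]
  · simp only [quasiPeriodicExtension_of_notMem α _ hx, smul_zero]

end QuasiField

/-! ### The action on divergence-free fields in the scatterer -/

namespace IsSymmetry

variable {v : Module.Basis (Fin 2) ℝ Plane} {D : Set Space} {g : Plane ≃ᵃⁱ[ℝ] Plane}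

/-- The action of `g` on the quasi-periodic extension of a field. -/
def extendedAction (_ : IsSymmetry v D g) (α : Plane) (f : Space → CVec) : Space → CVec :=
  fieldAction g (quasiPeriodicExtension v D α f)

variable (h : IsSymmetry v D g) (α : Plane)

include h

theorem isQuasiField_extendedAction {f : Space → CVec} (hf : MemLp f 2 (volume.restrict D)) :
    IsQuasiField v D (g.linearIsometryEquiv α) (h.extendedAction α f) :=
  h.isQuasiField_fieldAction (isQuasiField_quasiPeriodicExtension h.isOpen h.disjoint α hf)

theorem extendedAction_congr {f f' : Space → CVec} (hf : f =ᵐ[volume.restrict D] f') :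
    h.extendedAction α f =ᵐ[volume.restrict D] h.extendedAction α f' :=
  ae_restrict_of_ae (ae_eq_fieldAction g (h.disjoint.quasiPeriodicExtension_congr α
    ((ae_restrict_iff' h.isOpen.measurableSet).1 hf)))

theorem extendedAction_add (f f' : Space → CVec) :
    h.extendedAction α (fun y => f y + f' y) = h.extendedAction α f + h.extendedAction α f' := by
  funext x
  simp only [extendedAction, fieldAction, h.disjoint.quasiPeriodicExtension_add, rotate_add,
    Pi.add_apply]

theorem extendedAction_smul (c : ℂ) (f : Space → CVec) :
    h.extendedAction α (fun y => c • f y) = c • h.extendedAction α f := by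
  funext x
  simp only [extendedAction, fieldAction, h.disjoint.quasiPeriodicExtension_smul, rotate_smul,
    Pi.smul_apply]

theorem ae_eq_quasiPeriodicExtension (f : Space → CVec) :
    ∀ᵐ x, x ∈ D → f x = quasiPeriodicExtension v D α f x :=
  .of_forall fun _ hx => (h.disjoint.quasiPeriodicExtension_of_mem α f hx).symm

theorem quasiPeriodicExtension_ae_eq (f : Space → CVec) :
    quasiPeriodicExtension v D α f =ᵐ[volume.restrict D] f :=
  Filter.EventuallyEq.symm
    ((ae_restrict_iff' h.isOpen.measurableSet).2 (h.ae_eq_quasiPeriodicExtension α f))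

theorem isDivFree_extendedAction {f : Space → CVec} (hf : MemLp f 2 (volume.restrict D))
    (hdiv : IsDivFree D f) : IsDivFree D (h.extendedAction α f) := by
  have hq := isQuasiField_quasiPeriodicExtension h.isOpen h.disjoint α hf
  exact h.isDivFree_fieldAction hq.quasiPeriodic hq.memLp
    (isDivFree_congr h.isOpen.measurableSet (h.ae_eq_quasiPeriodicExtension α f) hdiv)

omit h in
/-- The action of `g` on `L²(D)`, through quasi-periodic extension with quasi-momentum `α`. -/
def lpAction (h : IsSymmetry v D g) (α : Plane) (f : Lp CVec 2 (volume.restrict D)) :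
    Lp CVec 2 (volume.restrict D) :=
  (h.isQuasiField_extendedAction α (Lp.memLp f)).memLp.toLp _

theorem coeFn_lpAction (f : Lp CVec 2 (volume.restrict D)) :
    h.lpAction α f =ᵐ[volume.restrict D] h.extendedAction α f :=
  MemLp.coeFn_toLp _

theorem isDivFree_lpAction {f : Lp CVec 2 (volume.restrict D)} (hdiv : IsDivFree D f) :
    IsDivFree D (h.lpAction α f) :=
  isDivFree_congr h.isOpen.measurableSet ((ae_restrict_iff' h.isOpen.measurableSet).1
    (h.coeFn_lpAction α f).symm) (h.isDivFree_extendedAction α (Lp.memLp f) hdiv)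

omit h in
/-- The action of `g` on `H(div 0, D)`, as a linear isometry. -/
def divFreeAction (h : IsSymmetry v D g) (α : Plane) : divFreeSpace D →ₗᵢ[ℂ] divFreeSpace D where
  toFun f := ⟨h.lpAction α f, h.isDivFree_lpAction α f.2⟩
  map_add' f f' := by
    refine Subtype.ext (Lp.ext ?_)
    refine (h.coeFn_lpAction α _).trans (.trans ?_ (Lp.coeFn_add _ _).symm)
    refine (h.extendedAction_congr α (Lp.coeFn_add (f : Lp CVec 2 (volume.restrict D)) f')).trans ?_
    refine (Filter.EventuallyEq.of_eq (h.extendedAction_add α _ _)).trans ?_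
    exact ((h.coeFn_lpAction α f).add (h.coeFn_lpAction α f')).symm
  map_smul' c f := by
    refine Subtype.ext (Lp.ext ?_)
    refine (h.coeFn_lpAction α _).trans (.trans ?_ (Lp.coeFn_smul _ _).symm)
    refine (h.extendedAction_congr α (Lp.coeFn_smul c (f : Lp CVec 2 (volume.restrict D)))).trans ?_
    refine (Filter.EventuallyEq.of_eq (h.extendedAction_smul α c _)).trans ?_
    exact ((h.coeFn_lpAction α f).const_smul c).symm
  norm_map' f := by
    change ‖h.lpAction α f‖ = ‖(f : Lp CVec 2 (volume.restrict D))‖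
    rw [lpAction, Lp.norm_toLp, extendedAction, h.eLpNorm_fieldAction
      (isQuasiField_quasiPeriodicExtension h.isOpen h.disjoint α (Lp.memLp _)), Lp.norm_def]
    congr 1
    exact eLpNorm_congr_ae (h.quasiPeriodicExtension_ae_eq α _)

theorem coeFn_divFreeAction (f : divFreeSpace D) :
    ((h.divFreeAction α f : Lp CVec 2 (volume.restrict D)) : Space → CVec)
      =ᵐ[volume.restrict D] h.extendedAction α (f : Lp CVec 2 (volume.restrict D)) :=
  h.coeFn_lpAction α f

/-- The moved field is already quasi-periodic and zero off the metasurface, so restricting it to `D`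
and extending again loses nothing; the actions therefore compose. -/
theorem divFreeAction_divFreeAction {g' : Plane ≃ᵃⁱ[ℝ] Plane} (h' : IsSymmetry v D g')
    (hg : g' * g = 1) (f : divFreeSpace D) :
    h'.divFreeAction (g.linearIsometryEquiv α) (h.divFreeAction α f) = f := by
  refine Subtype.ext (Lp.ext ?_)
  refine (h'.coeFn_divFreeAction _ _).trans ?_
  refine (h'.extendedAction_congr _ (h.coeFn_divFreeAction α f)).trans ?_
  have hq := h.isQuasiField_extendedAction α (Lp.memLp (f : Lp CVec 2 (volume.restrict D)))
  rw [extendedAction, h.disjoint.quasiPeriodicExtension_eq hq.quasiPeriodic hq.eq_zero,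
    extendedAction, fieldAction_mul, hg, fieldAction_one]
  exact h.quasiPeriodicExtension_ae_eq α _

omit h in
theorem linear_inv_linear (_ : IsSymmetry v D g) (α : Plane) :
    g⁻¹.linearIsometryEquiv (g.linearIsometryEquiv α) = α := by
  rw [linear_inv]
  exact g.linearIsometryEquiv.symm_apply_apply α

omit h in
/-- The action of `g` on `H(div 0, D)`, as an isometric automorphism. -/
def divFreeEquiv (h : IsSymmetry v D g) (α : Plane) : divFreeSpace D ≃ₗᵢ[ℂ] divFreeSpace D :=
  { h.divFreeAction α with
    invFun := h.inv.divFreeAction (g.linearIsometryEquiv α)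
    left_inv := h.divFreeAction_divFreeAction α h.inv (inv_mul_cancel g)
    right_inv := fun f => by
      have := h.inv.divFreeAction_divFreeAction (g.linearIsometryEquiv α) h (mul_inv_cancel g) f
      rwa [h.linear_inv_linear] at this }

theorem operatorGraph_divFreeAction {τ : ℝ} {ω : ℂ} {f : divFreeSpace D}
    {ψ ψ' : Space → CVec} (hψ : ∀ᵐ x ∂volume.restrict D, h.extendedAction α ψ x = ψ' x)
    (hgr : OperatorGraph v D τ α ω (f : Lp CVec 2 (volume.restrict D)) ψ) :
    OperatorGraph v D τ (g.linearIsometryEquiv α) ω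
      (h.divFreeAction α f : Lp CVec 2 (volume.restrict D)) ψ' := by
  have hm := h.isOpen.measurableSet
  have h1 := operatorGraph_congr hm (h.ae_eq_quasiPeriodicExtension α _)
    (h.ae_eq_quasiPeriodicExtension α _) hgr
  exact operatorGraph_congr hm ((ae_restrict_iff' hm).1 (h.coeFn_divFreeAction α f).symm)
    ((ae_restrict_iff' hm).1 hψ)
    (h.operatorGraph_fieldAction (h.disjoint.isQuasiPeriodic α _)
      (h.disjoint.isQuasiPeriodic α _) h1)

/-! ### Invariance of the resonances -/

theorem isInvertible_of_isInvertible {τ : ℝ} {ω : ℂ} (hB : IsInvertible v D τ α ω) :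
    IsInvertible v D τ (g.linearIsometryEquiv α) ω := by
  obtain ⟨B, hB⟩ := hB
  let U := (h.divFreeEquiv α).toContinuousLinearEquiv
  -- The operator at the rotated quasi-momentum is the conjugate `U B U⁻¹`.
  refine ⟨(U.symm.trans B).trans U, fun φ => ?_⟩
  have h1 := h.operatorGraph_divFreeAction α (h.coeFn_divFreeAction α (B (U.symm φ))).symm
    (hB (U.symm φ))
  have h2 : h.divFreeAction α (U.symm φ) = φ := U.apply_symm_apply φ
  rwa [h2] at h1

theorem isInvertible_iff (τ : ℝ) (ω : ℂ) :
    IsInvertible v D τ (g.linearIsometryEquiv α) ω ↔ IsInvertible v D τ α ω := by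
  refine ⟨fun hB => ?_, h.isInvertible_of_isInvertible α⟩
  have := h.inv.isInvertible_of_isInvertible _ hB
  rwa [h.linear_inv_linear] at this

theorem resonances_eq (τ : ℝ) :
    resonances v D τ (g.linearIsometryEquiv α) = resonances v D τ α := by
  simp only [resonances, h.isInvertible_iff, h.preserves.threshold_apply]

theorem operatorGraph_zero {τ : ℝ} {ω : ℂ} {f : divFreeSpace D}
    (hgr : OperatorGraph v D τ α ω (f : Lp CVec 2 (volume.restrict D)) fun _ => 0) :
    OperatorGraph v D τ (g.linearIsometryEquiv α) ω
      (h.divFreeAction α f : Lp CVec 2 (volume.restrict D)) fun _ => 0 := by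
  refine h.operatorGraph_divFreeAction α (.of_forall fun x => ?_) hgr
  -- Homogeneity with the scalar `0` shows that the zero field is sent to zero.
  have := congrFun (h.extendedAction_smul α 0 fun _ => 0) x
  simpa using this

theorem geometricMultiplicity_eq (τ : ℝ) (ω : ℂ) :
    geometricMultiplicity v D τ (g.linearIsometryEquiv α) ω = geometricMultiplicity v D τ α ω := by
  let U := (h.divFreeEquiv α).toLinearEquiv
  have himage : {φ : divFreeSpace D | OperatorGraph v D τ (g.linearIsometryEquiv α) ω
        (φ : Lp CVec 2 (volume.restrict D)) (fun _ => 0)} =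
      U '' {φ : divFreeSpace D | OperatorGraph v D τ α ω
        (φ : Lp CVec 2 (volume.restrict D)) (fun _ => 0)} := by
    ext φ
    constructor
    · intro hφ
      refine ⟨U.symm φ, ?_, U.apply_symm_apply φ⟩
      have := h.inv.operatorGraph_zero _ hφ
      rwa [h.linear_inv_linear] at this
    · rintro ⟨φ, hφ, rfl⟩
      exact h.operatorGraph_zero α hφ
  rw [geometricMultiplicity, geometricMultiplicity, himage]
  have hspan := Submodule.map_span U.toLinearMap {φ : divFreeSpace D | OperatorGraph v D τ α ω
    (φ : Lp CVec 2 (volume.restrict D)) (fun _ => 0)}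
  change Submodule.map _ _ = Submodule.span ℂ (U '' _) at hspan
  rw [← hspan, LinearEquiv.rank_eq (U.submoduleMap _).symm]

theorem bandFunction_eq (τ : ℝ) (lt : ℂ → ℂ → Prop) (j : ℕ) :
    bandFunction v D τ lt j (g.linearIsometryEquiv α) = bandFunction v D τ lt j α := by
  have hcopies : resonanceCopies v D τ (g.linearIsometryEquiv α) = resonanceCopies v D τ α := by
    simp only [resonanceCopies, h.resonances_eq, h.geometricMultiplicity_eq]
  have hband : IsBandValue v D τ lt j (g.linearIsometryEquiv α) = IsBandValue v D τ lt j α := by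
    funext z
    simp only [IsBandValue, hcopies]
  -- Equal predicates yield the same chosen value, so neither uniqueness of the band value nor any
  -- property of `lt` is needed.
  have hchoose : ∀ P Q : ℂ → Prop, P = Q → (open Classical in
      if h : ∃ z, P z then some h.choose else none) =
      (open Classical in if h : ∃ z, Q z then some h.choose else none) := by
    rintro P _ rfl
    rfl
  exact hchoose _ _ hband

/-! ### Eigenfunctions -/

omit α in
theorem isEigenfunction_fieldAction {τ : ℝ} {α : Plane} {ω : ℂ} {φ : Space → CVec}
    (hφ : IsEigenfunction v D τ α ω φ) :
    IsEigenfunction v D τ (g.linearIsometryEquiv α) ω (fieldAction g φ) := by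
  obtain ⟨hmem, hne, hdiv, hgr⟩ := hφ
  obtain ⟨ψ, hψ, hae⟩ := (memL2Quasi_iff h.isOpen h.disjoint φ).1 hmem
  have hm := h.isOpen.measurableSet
  have haeg := ae_eq_fieldAction g hae
  have haeD : ∀ᵐ x, x ∈ D → φ x = ψ x := hae.mono fun _ hx _ => hx
  have haegD : ∀ᵐ x, x ∈ D → fieldAction g ψ x = fieldAction g φ x :=
    haeg.mono fun _ hx _ => hx.symm
  refine ⟨(memL2Quasi_iff h.isOpen h.disjoint _).2 ⟨_, h.isQuasiField_fieldAction hψ, haeg⟩,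
    fun h0 => hne ?_, ?_, ?_⟩
  · have h1 := ae_eq_fieldAction g⁻¹ (ψ := fun _ => 0) h0
    rw [fieldAction_inv_fieldAction] at h1
    exact h1.mono fun x hx => hx.trans (rotate_zero _)
  · exact isDivFree_congr hm haegD (h.isDivFree_fieldAction hψ.quasiPeriodic hψ.memLp
      (isDivFree_congr hm haeD hdiv))
  · have hgr' : OperatorGraph v D τ α ω ψ fun _ => 0 :=
      operatorGraph_congr hm haeD (.of_forall fun _ _ => rfl) hgr
    have hzero : IsQuasiPeriodic v α fun _ => 0 := fun γ _ x => (smul_zero _).symm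
    have hact : fieldAction g (fun _ => 0) = fun _ => 0 := funext fun x => rotate_zero _
    have hgrg := h.operatorGraph_fieldAction hψ.quasiPeriodic hzero hgr'
    rw [hact] at hgrg
    exact operatorGraph_congr hm haegD (.of_forall fun _ _ => rfl) hgrg

end IsSymmetry

end

end Metasurface

/-! ### The three claims -/

open Metasurface
theorem mainTheorem12
    (v : Module.Basis (Fin 2) ℝ Plane) (hv : volume (cell v) = 1)
    (D : Set Space) (hDopen : IsOpen D) (hDbdd : Bornology.IsBounded D)
    (hDsmooth : HasSmoothBoundary D)
    (hDcell : ∃ h : ℝ, 0 < h ∧ D ⊆ cell v ×ˢ Set.Icc (-h) h)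
    (hΛ : translationVectors v D = (lattice v : Set Plane))
    (τ : ℝ) (hτ : 0 < τ) :
    (∀ R ∈ pointGroup v D, ∀ α ∈ brillouinZone v,
      R α ∈ brillouinZone v ∧
      resonances v D τ (R α) = resonances v D τ α ∧
      (∀ ω ∈ resonances v D τ α,
        geometricMultiplicity v D τ (R α) ω = geometricMultiplicity v D τ α ω) ∧
      ∀ (lt : ℂ → ℂ → Prop) [IsStrictTotalOrder ℂ lt] (j : ℕ),
        bandFunction v D τ lt j (R α) = bandFunction v D τ lt j α) ∧
    (∀ g ∈ symmetryGroup v D, ∀ α ∈ brillouinZone v, ∀ ω ∈ resonances v D τ α,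
      ∀ φ : Space → CVec, IsEigenfunction v D τ α ω φ →
        ω ∈ resonances v D τ (g.linearIsometryEquiv α) ∧
        IsEigenfunction v D τ (g.linearIsometryEquiv α) ω (fieldAction g φ)) ∧
    (∀ g ∈ symmetryGroup v D, ∀ α ∈ brillouinZone v, ∀ ω : ℂ, ω ^ 2 ∉ threshold v α →
      ∀ φ : Space → CVec, MemL2Quasi v D α φ →
        (∀ θ : Space → CVec, IsTest θ →
          electricPotential v D (g.linearIsometryEquiv α) ω (fieldAction g φ)
            (fieldAction g θ) = electricPotential v D α ω φ θ) ∧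
        ∀ u : Space → CVec,
          IsElectricPotential v D (g.linearIsometryEquiv α) ω (fieldAction g φ)
            (fieldAction g u) ↔ IsElectricPotential v D α ω φ u) := by
  obtain ⟨_, _, hcell⟩ := hDcell
  have hdisj := hasDisjointTranslates_of_subset_cell hDopen hcell
  have hsym : ∀ g ∈ symmetryGroup v D, IsSymmetry v D g := fun g hg =>
    ⟨hDopen, hdisj, hg, preservesLattice_linear hΛ hg⟩
  refine ⟨?_, ?_, ?_⟩
  · rintro _ ⟨g, hg, rfl⟩ α hα
    have h := hsym g hg
    exact ⟨h.preserves.apply_mem_brillouinZone hα, h.resonances_eq α τ,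
      fun ω _ => h.geometricMultiplicity_eq α τ ω, fun lt _ j => h.bandFunction_eq α τ lt j⟩
  · intro g hg α _ ω hω φ hφ
    have h := hsym g hg
    exact ⟨by rwa [h.resonances_eq], h.isEigenfunction_fieldAction hφ⟩
  · intro g hg α _ ω _ φ hφ
    have h := hsym g hg
    have hm := hDopen.measurableSet
    obtain ⟨ψ, hψ, hae⟩ := (memL2Quasi_iff hDopen hdisj φ).1 hφ
    have haeD : ∀ᵐ x, x ∈ D → φ x = ψ x := hae.mono fun _ hx _ => hx
    have haegD : ∀ᵐ x, x ∈ D → fieldAction g φ x = fieldAction g ψ x :=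
      (ae_eq_fieldAction g hae).mono fun _ hx _ => hx
    refine ⟨fun θ hθ => ?_, fun u => ?_⟩
    · rw [electricPotential_congr hm _ ω haegD, electricPotential_congr hm α ω haeD,
        h.electricPotential_fieldAction ω hψ.quasiPeriodic hθ]
    · rw [isElectricPotential_congr hm _ ω haegD, isElectricPotential_congr hm α ω haeD,
        h.isElectricPotential_fieldAction_iff ω hψ.quasiPeriodic]
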